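/- Let $M$ be a smooth manifold (Hausdorff, second countable, without boundary) of dimension $n$. Write $A^k(M)=\Gamma(\wedge^kTM)$ (with $A^{0}(M)=C^\infty(M)$, and $A^k(M)=0$ for $k<0$), $\mathcal A(M)=\bigoplus_k A^k(M)$, and let $[\cdot,\cdot]$ be the Schouten–Nijenhuis bracket on $\mathcal A(M)$: the $\mathbb R$-bilinear bracket $A^k(M)\times A^l(M)\to A^{k+l-1}(M)$ with $[f,g]=0$ for functions, $[X,Q]=L_XQ$ for vector fields $X$, $[P,Q]=-(-1)^{(p-1)(q-1)}[Q,P]$, and $[P,Q\wedge R]=[P,Q]\wedge R+(-1)^{(p-1)q}Q\wedge[P,R]$ for $P\in A^p(M)$, $Q\in A^q(M)$, $R\in\mathcal A(M)$. A *higher connection* on $M$ is a map $\nabla:\mathcal A(M)\times\mathcal A(M)\to\mathcal A(M)$ such that, for $f\in C^\infty(M)$ and multivector fields $X,X',Y,Y'$: (i) $\nabla_XY\in A^{k+l-1}(M)$ if $X\in A^k(M)$, $Y\in A^l(M)$; (ii) $\nabla_{fX+X'}Y=f\nabla_XY+\nabla_{X'}Y$; (iii) $\nabla_X(Y+Y')=\nabla_XY+\nabla_XY'$;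 (iv) $\nabla_Xf=[X,f]$ for $X\in A^k(M)$; (v) $\nabla_X(fY)=[X,f]\wedge Y+f\nabla_XY$ for $X\in A^k(M)$; (vi) $\nabla_fX=0$. Its *higher torsion* is $T(X,Y)=\nabla_XY-(-1)^{(k-1)(l-1)}\nabla_YX-[X,Y]$ for $X\in A^k(M)$, $Y\in A^l(M)$. It is *almost torsion-free* if $T(X,Y)=0$ for all $X,Y\in A^1(M)$, and $T(X,Y)=0$ for all homogeneous $X,Y$ with $X\wedge Y=0$. For forms put $(i_X\omega)(Y)=\omega(X\wedge Y)$ and, for $X\in A^k(M)$, $L_X\omega=d\,i_X\omega-(-1)^k i_X\,d\omega$. For $X\in A^k(M)$ with $k>0$, $\omega\in\Omega^l(M)$ with $l-k+1\ge0$, and $Y\in A^{l-k+1}(M)$, put $$(\nabla_X\omega)(Y)=(-1)^{(k-1)(l-1)}L_Xi_Y\omega-\omega(\nabla_XY).$$ An *associative bilinear form* $\eta$ on $M$ is a smooth fibrewise $\mathbb R$-bilinear form on $\wedge^\bullet TM$ with $\eta(x\wedge y,z)=\eta(x,y\wedge z)$. Its components are the forms $\omega^{(t)}\in\Omega^t(M)$,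 $\omega^{(t)}(x)=\eta(x,1)$ for $x\in\wedge^tT_pM$. One writes $\nabla\eta\equiv0$ if $(\nabla_X\omega^{(k+l+m-1)})(Y\wedge Z)=0$ for all $X\in A^k(M)$, $Y\in A^l(M)$, $Z\in A^m(M)$ with $k>0$ and $l+m>0$. **Theorem.** Let $\eta$ be an associative bilinear form on $M$ with $\omega^{(1)}\equiv0$. 1. If, for every $t>1$ with $\omega^{(t)}\not\equiv0$, the form $\omega^{(t)}$ is nowhere vanishing ($\omega^{(t)}_p\ne0$ for all $p\in M$), then $M$ admits an almost torsion-free higher connection $\nabla$ with $\nabla\eta\equiv0$. 2. In particular, this holds if, for every $t>1$ with $\omega^{(t)}\not\equiv0$, the form $\omega^{(t)}$ is multisymplectic, i.e. $d\omega^{(t)}=0$ and, for all $p\in M$ and $v\in T_pM$, $i_v\omega^{(t)}=0$ if and only if $v=0$. -/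

import Mathlib

open scoped Manifold ContDiff Topology

noncomputable section

namespace HigherConn

/-! ## Multilinear algebra and calculus on the model space `ℝⁿ` -/

/-- The model space `ℝⁿ`. -/
abbrev Model (n : ℕ) : Type := EuclideanSpace ℝ (Fin n)

/-- The standard basis `e₁, …, eₙ` of `ℝⁿ`. -/
def stdBasis (n : ℕ) : Module.Basis (Fin n) ℝ (Model n) :=
  (EuclideanSpace.basisFun (Fin n) ℝ).toBasis

/-- The basis `e_S = e_{i₁} ∧ ⋯ ∧ e_{iₖ}`, `S = {i₁ < ⋯ < iₖ}`, of `∧^• ℝⁿ`. -/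
def extBasis (n : ℕ) : Module.Basis (Finset (Fin n)) ℝ (ExteriorAlgebra ℝ (Model n)) :=
  (stdBasis n).ExteriorAlgebra

/-- The componentwise partial derivative `∂P/∂xⁱ` at `y` of a multivector valued function on
`ℝⁿ`. -/
def partialMV {n : ℕ} (P : Model n → ExteriorAlgebra ℝ (Model n)) (i : Fin n) (y : Model n) :
    ExteriorAlgebra ℝ (Model n) :=
  ∑ S : Finset (Fin n),
    fderiv ℝ (fun z => (extBasis n).repr (P z) S) y (stdBasis n i) • extBasis n S

/-- The contraction `dxⁱ ⌟ x` of a multivector with `dxⁱ` (in the first slot); it is the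
antiderivation of `∧^• ℝⁿ` with `dxⁱ ⌟ v = vⁱ` on vectors. -/
def contr {n : ℕ} (i : Fin n) (x : ExteriorAlgebra ℝ (Model n)) : ExteriorAlgebra ℝ (Model n) :=
  CliffordAlgebra.contractLeft (Q := (0 : QuadraticForm ℝ (Model n))) ((stdBasis n).coord i) x

/-- The Schouten–Nijenhuis bracket of multivector fields on `ℝⁿ`: for `P` of degree `k`,
`[P, Q] = ∑ᵢ ((-1)^(k-1) (dxⁱ ⌟ P) ∧ ∂ᵢQ - ∂ᵢP ∧ (dxⁱ ⌟ Q))`.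
The grade involution produces the sign `(-1)^(k-1)`, as `dxⁱ ⌟ P` has degree `k - 1`. -/
def schoutenLocal {n : ℕ} (P Q : Model n → ExteriorAlgebra ℝ (Model n)) (y : Model n) :
    ExteriorAlgebra ℝ (Model n) :=
  ∑ i : Fin n,
    (CliffordAlgebra.involute (Q := (0 : QuadraticForm ℝ (Model n))) (contr i (P y))
        * partialMV Q i y
      - partialMV P i y * contr i (Q y))

/-- Alternating maps on `ℝⁿ` are continuous. -/
theorem continuous_alternating {n k : ℕ} (f : Model n [⋀^Fin k]→ₗ[ℝ] ℝ) : Continuous f := by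
  have h : ∀ v : Fin k → Model n,
      f v = ∑ r : Fin k → Fin n, (∏ i, (v i) (r i)) • f (fun i => stdBasis n (r i)) := by
    intro v
    have hv : v = fun i => ∑ j, (v i) j • stdBasis n j := by
      funext i
      have := (stdBasis n).sum_repr (v i)
      simpa [stdBasis] using this.symm
    have h1 : f v = f.toMultilinearMap (fun i => ∑ j, (v i) j • stdBasis n j) := by
      rw [← hv]; rfl
    rw [h1, MultilinearMap.map_sum]
    refine Finset.sum_congr rfl fun r _ => ?_
    exact f.toMultilinearMap.map_smul_univ _ _
  have h' : (f : (Fin k → Model n) → ℝ) =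
      fun v => ∑ r : Fin k → Fin n, (∏ i, (v i) (r i)) • f (fun i => stdBasis n (r i)) :=
    funext h
  rw [h']
  fun_prop

/-- The degree `k` part of a covector `α ∈ (∧^• ℝⁿ)*`, as an alternating form
`(v₁, …, vₖ) ↦ α (v₁ ∧ ⋯ ∧ vₖ)`. -/
def altPart {n : ℕ} (k : ℕ) (α : Module.Dual ℝ (ExteriorAlgebra ℝ (Model n))) :
    Model n [⋀^Fin k]→L[ℝ] ℝ :=
  { α.compAlternatingMap (ExteriorAlgebra.ιMulti ℝ k) with
    cont := continuous_alternating (α.compAlternatingMap (ExteriorAlgebra.ιMulti ℝ k)) }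

/-- The exterior derivative on `ℝⁿ` of an inhomogeneous form `α : ℝⁿ → (∧^• ℝⁿ)*`, degree by
degree. -/
def extDerivLocal {n : ℕ} (α : Model n → Module.Dual ℝ (ExteriorAlgebra ℝ (Model n)))
    (y : Model n) : Module.Dual ℝ (ExteriorAlgebra ℝ (Model n)) :=
  ExteriorAlgebra.liftAlternating fun k =>
    match k with
    | 0 => 0
    | k + 1 => (extDeriv (fun z => altPart k (α z)) y).toAlternatingMap

/-! ## Multivector fields and differential forms on a manifold -/

section Manifold

variable {n : ℕ} {M : Type*} [TopologicalSpace M] [ChartedSpace (Model n) M]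

/-- The fibre `∧^• T_pM` of the full exterior bundle. -/
abbrev ExtFibre (n : ℕ) {M : Type*} [TopologicalSpace M] [ChartedSpace (Model n) M]
    (p : M) : Type :=
  ExteriorAlgebra ℝ (TangentSpace (𝓡 n) p)

/-- The (not necessarily smooth) sections of the full exterior bundle `∧^• TM`. -/
abbrev RoughMVF (n : ℕ) (M : Type*) [TopologicalSpace M] [ChartedSpace (Model n) M] : Type _ :=
  (p : M) → ExtFibre n p

/-- The (not necessarily smooth) inhomogeneous differential forms, as sections of
`(∧^• TM)* ≅ ∧^• T*M`. -/
abbrev RoughForm (n : ℕ) (M : Type*) [TopologicalSpace M] [ChartedSpace (Model n) M] : Type _ :=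
  (p : M) → Module.Dual ℝ (ExtFibre n p)

/-- The differential at `q` of the chart around `p`. -/
def chartDiff (p q : M) : TangentSpace (𝓡 n) q →L[ℝ] Model n :=
  mfderiv (𝓡 n) 𝓘(ℝ, Model n) (extChartAt (𝓡 n) p) q

/-- The differential at `q` of the chart around `p`, extended to `∧^• T_qM → ∧^• ℝⁿ`. -/
def chartExt (p q : M) : ExtFibre n q →ₐ[ℝ] ExteriorAlgebra ℝ (Model n) :=
  ExteriorAlgebra.map (chartDiff p q).toLinearMap

/-- The inverse of the differential at `q` of the chart around `p`, extended to
`∧^• ℝⁿ → ∧^• T_qM`. -/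
def chartExtInv (p q : M) : ExteriorAlgebra ℝ (Model n) →ₐ[ℝ] ExtFibre n q :=
  ExteriorAlgebra.map (chartDiff p q).inverse.toLinearMap

/-- A section of `∧^• TM`, read in the chart around `p`. -/
def coordMVF (X : RoughMVF n M) (p : M) (y : Model n) : ExteriorAlgebra ℝ (Model n) :=
  chartExt p ((extChartAt (𝓡 n) p).symm y) (X ((extChartAt (𝓡 n) p).symm y))

/-- A differential form, read in the chart around `p`. -/
def coordForm (α : RoughForm n M) (p : M) (y : Model n) :
    Module.Dual ℝ (ExteriorAlgebra ℝ (Model n)) :=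
  α ((extChartAt (𝓡 n) p).symm y) ∘ₗ
    (chartExtInv p ((extChartAt (𝓡 n) p).symm y)).toLinearMap

/-- A section of `∧^• TM` is smooth if its coefficients in the charts are. -/
def IsSmoothMVF (X : RoughMVF n M) : Prop :=
  ∀ (p : M) (S : Finset (Fin n)),
    ContDiffOn ℝ ∞ (fun y => (extBasis n).repr (coordMVF X p y) S) (extChartAt (𝓡 n) p).target

/-- The Schouten–Nijenhuis bracket at `p`, computed in the chart around `p`. -/
def schouten (X Y : RoughMVF n M) : RoughMVF n M := fun p =>
  chartExtInv p p (schoutenLocal (coordMVF X p) (coordMVF Y p) (extChartAt (𝓡 n) p p))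

/-- The exterior derivative at `p`, computed in the chart around `p`. -/
def extDerivForm (α : RoughForm n M) : RoughForm n M := fun p =>
  extDerivLocal (coordForm α p) (extChartAt (𝓡 n) p p) ∘ₗ
    (chartExt p p).toLinearMap

/-- The interior product, `(i_X α)(Y) = α(X ∧ Y)`. -/
def interior (X : RoughMVF n M) (α : RoughForm n M) : RoughForm n M := fun p =>
  α p ∘ₗ LinearMap.mulLeft ℝ (X p)

/-- The Lie derivative `L_X α = d i_X α - (-1)^k i_X dα` along a multivector field of degree
`k`. -/
def lieDerivForm (k : ℕ) (X : RoughMVF n M) (α : RoughForm n M) : RoughForm n M := fun p =>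
  extDerivForm (interior X α) p - (-1 : ℝ) ^ k • interior X (extDerivForm α) p

theorem mul_repr_smooth {s : Set (Model n)} {P Q : Model n → ExteriorAlgebra ℝ (Model n)}
    (hP : ∀ S, ContDiffOn ℝ ∞ (fun y => (extBasis n).repr (P y) S) s)
    (hQ : ∀ S, ContDiffOn ℝ ∞ (fun y => (extBasis n).repr (Q y) S) s) (S : Finset (Fin n)) :
    ContDiffOn ℝ ∞ (fun y => (extBasis n).repr (P y * Q y) S) s := by
  have h : ∀ y, (extBasis n).repr (P y * Q y) S =
      ∑ A, ∑ B, (extBasis n).repr (P y) A * ((extBasis n).repr (Q y) B *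
        (extBasis n).repr (extBasis n A * extBasis n B) S) := by
    intro y
    conv_lhs => rw [← (extBasis n).sum_repr (P y), ← (extBasis n).sum_repr (Q y)]
    simp only [Finset.sum_mul, Finset.mul_sum, map_sum, Finsupp.finsetSum_apply, smul_mul_assoc,
      mul_smul_comm, map_smul, Finsupp.smul_apply, smul_eq_mul]
    rw [Finset.sum_comm]
    refine Finset.sum_congr rfl fun A _ => Finset.sum_congr rfl fun B _ => ?_
    ring
  simp only [h]
  exact ContDiffOn.sum fun A _ => ContDiffOn.sum fun B _ =>
    (hP A).mul ((hQ B).mul contDiffOn_const)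

variable (n M) in
/-- The algebra `𝒜(M) = ⨁ₖ A^k(M)` of multivector fields, i.e. of smooth sections of `∧^• TM`,
under the (pointwise) exterior product. -/
def mvfAlgebra : Subalgebra ℝ (RoughMVF n M) where
  carrier := {X | IsSmoothMVF X}
  add_mem' {X Y} hX hY p S := by
    refine ((hX p S).add (hY p S)).congr fun y _ => ?_
    simp only [coordMVF, Pi.add_apply, map_add, Finsupp.add_apply]
  mul_mem' {X Y} hX hY p S := by
    refine (mul_repr_smooth (hX p) (hY p) S).congr fun y _ => ?_
    simp only [coordMVF, Pi.mul_apply, map_mul]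
  algebraMap_mem' r p S := by
    refine (contDiffOn_const
      (c := (extBasis n).repr (algebraMap ℝ (ExteriorAlgebra ℝ (Model n)) r) S)).congr
        fun y _ => ?_
    simp only [coordMVF, Pi.algebraMap_apply, AlgHom.commutes]

variable (n M) in
/-- The multivector fields on `M`. -/
abbrev MVF : Type _ := mvfAlgebra n M

/-- `X ∈ A^k(M)`: the multivector field `X` is homogeneous of degree `k`. -/
def MVF.HasDegree (k : ℕ) (X : MVF n M) : Prop :=
  ∀ p : M, X.1 p ∈ ⋀[ℝ]^k (TangentSpace (𝓡 n) p)

/-- A smooth function, as an element of `A^0(M) = C^∞(M)`. The product `f X` of a function and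
a multivector field is then the product `ofFun f * X` in `𝒜(M)`. -/
def ofFun [IsManifold (𝓡 n) ∞ M] (f : C^∞⟮𝓡 n, M; ℝ⟯) : MVF n M :=
  ⟨fun p => algebraMap ℝ (ExtFibre n p) (f p), fun p S => by
    have hf : ContDiffOn ℝ ∞ (fun y => f ((extChartAt (𝓡 n) p).symm y))
        (extChartAt (𝓡 n) p).target :=
      (f.contMDiff.comp_contMDiffOn (contMDiffOn_extChartAt_symm p)).contDiffOn
    refine (hf.mul (contDiffOn_const
      (c := (extBasis n).repr (1 : ExteriorAlgebra ℝ (Model n)) S))).congr fun y _ => ?_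
    simp only [coordMVF, Algebra.algebraMap_eq_smul_one, map_smul, map_one,
      Finsupp.smul_apply, smul_eq_mul]⟩

/-! ## Higher connections -/

/-- A higher affine connection on `M`. -/
structure HigherConnection (n : ℕ) (M : Type*) [TopologicalSpace M] [ChartedSpace (Model n) M]
    [IsManifold (𝓡 n) ∞ M] where
  /-- `cov X Y` is `∇_X Y`. -/
  cov : MVF n M → MVF n M → MVF n M
  /-- `∇_X Y ∈ A^(k+l-1)(M)` for `X ∈ A^k(M)`, `Y ∈ A^l(M)`. For `k = l = 0`, where
  `A^(-1)(M) = 0`, this is part of `cov_ofFun_left`. -/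
  hasDegree_cov : ∀ {k l j : ℕ} {X Y : MVF n M}, j + 1 = k + l →
    X.HasDegree k → Y.HasDegree l → (cov X Y).HasDegree j
  /-- `∇_(fX + X') Y = f ∇_X Y + ∇_X' Y`. -/
  cov_linear_left : ∀ (f : C^∞⟮𝓡 n, M; ℝ⟯) (X X' Y : MVF n M),
    cov (ofFun f * X + X') Y = ofFun f * cov X Y + cov X' Y
  /-- `∇_X (Y + Y') = ∇_X Y + ∇_X Y'`. -/
  cov_add_right : ∀ X Y Y' : MVF n M, cov X (Y + Y') = cov X Y + cov X Y'
  /-- `∇_X f = [X, f]`. -/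
  cov_ofFun_right : ∀ {k : ℕ} {X : MVF n M} (f : C^∞⟮𝓡 n, M; ℝ⟯), X.HasDegree k →
    (cov X (ofFun f)).1 = schouten X.1 (ofFun f).1
  /-- `∇_X (f Y) = [X, f] ∧ Y + f ∇_X Y`. -/
  cov_leibniz : ∀ {k : ℕ} {X : MVF n M} (f : C^∞⟮𝓡 n, M; ℝ⟯) (Y : MVF n M), X.HasDegree k →
    (cov X (ofFun f * Y)).1 = schouten X.1 (ofFun f).1 * Y.1 + (ofFun f * cov X Y).1
  /-- `∇_f X = 0`. -/
  cov_ofFun_left : ∀ (f : C^∞⟮𝓡 n, M; ℝ⟯) (X : MVF n M), cov (ofFun f) X = 0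

namespace HigherConnection

variable [IsManifold (𝓡 n) ∞ M]

/-- The higher torsion
`T(X, Y) = ∇_X Y - (-1)^((k-1)(l-1)) ∇_Y X - [X, Y]` for `X ∈ A^k(M)`, `Y ∈ A^l(M)`. -/
def torsion (D : HigherConnection n M) (k l : ℕ) (X Y : MVF n M) : RoughMVF n M :=
  (D.cov X Y).1 - (-1 : ℝ) ^ (((k : ℤ) - 1) * ((l : ℤ) - 1)) • (D.cov Y X).1 - schouten X.1 Y.1

/-- `∇` is almost torsion-free: `T(X, Y) = 0` for all vector fields `X`, `Y`, and for all
`X ∈ A^k(M)`, `Y ∈ A^l(M)` with `X ∧ Y = 0`. -/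
def AlmostTorsionFree (D : HigherConnection n M) : Prop :=
  (∀ X Y : MVF n M, X.HasDegree 1 → Y.HasDegree 1 → D.torsion 1 1 X Y = 0) ∧
  (∀ (k l : ℕ) (X Y : MVF n M), X.HasDegree k → Y.HasDegree l → X * Y = 0 →
    D.torsion k l X Y = 0)

/-- The function `(∇_X α)(Y) = (-1)^((k-1)(l-1)) L_X (i_Y α) - α(∇_X Y)` for `X ∈ A^k(M)`,
`α ∈ Ω^l(M)`, `Y ∈ A^(l-k+1)(M)`, where `k > 0` and `l - k + 1 ≥ 0`. Here `L_X (i_Y α)` is a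
`0`-form; the function is its value on the unit `1 ∈ ∧^0 T_pM`. -/
def covForm (D : HigherConnection n M) (k l : ℕ) (X : MVF n M) (α : RoughForm n M)
    (Y : MVF n M) (p : M) : ℝ :=
  (-1 : ℝ) ^ (((k : ℤ) - 1) * ((l : ℤ) - 1)) * lieDerivForm k X.1 (interior Y.1 α) p 1
    - α p ((D.cov X Y).1 p)

end HigherConnection

/-! ## Associative bilinear forms -/

/-- A smooth fibrewise bilinear form `η` on `∧^• TM` with `η(x ∧ y, z) = η(x, y ∧ z)`. -/
structure AssocForm (n : ℕ) (M : Type*) [TopologicalSpace M] [ChartedSpace (Model n) M] where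
  /-- The bilinear form on the fibre over `p`. -/
  form : (p : M) → ExtFibre n p →ₗ[ℝ] ExtFibre n p →ₗ[ℝ] ℝ
  assoc : ∀ (p : M) (x y z : ExtFibre n p), form p (x * y) z = form p x (y * z)
  smooth : ∀ {k l : ℕ} {X Y : MVF n M}, X.HasDegree k → Y.HasDegree l →
    ContMDiff (𝓡 n) 𝓘(ℝ, ℝ) ∞ (fun p => form p (X.1 p) (Y.1 p))

namespace AssocForm

/-- The `t`-form component `ω^(t)` of `η`, given by `ω^(t)(x) = η(x, 1)` for `x ∈ ∧^t T_pM`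
(and by `0` on `∧^k T_pM`, `k ≠ t`). -/
def component (η : AssocForm n M) (t : ℕ) : RoughForm n M := fun p =>
  (η.form p).flip 1 ∘ₗ GradedAlgebra.proj (fun i => ⋀[ℝ]^i (TangentSpace (𝓡 n) p)) t

/-- The `1`-form component of `η` vanishes and, for each `t > 1`, the component `ω^(t)` is
either identically zero or nowhere zero. -/
def IsNonvanishing (η : AssocForm n M) : Prop :=
  η.component 1 = 0 ∧
  ∀ t : ℕ, 1 < t → η.component t ≠ 0 → ∀ p : M, η.component t p ≠ 0

/-- A form `α` (of positive degree) is multisymplectic if it is closed and, for all `p` and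
`v ∈ T_pM`, one has `i_v α = 0` if and only if `v = 0`. -/
def IsMultisymplectic (α : RoughForm n M) : Prop :=
  extDerivForm α = 0 ∧
  ∀ (p : M) (v : TangentSpace (𝓡 n) p),
    α p ∘ₗ LinearMap.mulLeft ℝ (ExteriorAlgebra.ι ℝ v) = 0 ↔ v = 0

/-- The `1`-form component of `η` vanishes and, for each `t > 1`, the component `ω^(t)` is
either identically zero or multisymplectic. -/
def IsPlectic (η : AssocForm n M) : Prop :=
  η.component 1 = 0 ∧
  ∀ t : ℕ, 1 < t → η.component t ≠ 0 → IsMultisymplectic (η.component t)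

/-- `∇η ≡ 0`: for all `X ∈ A^k(M)`, `Y ∈ A^l(M)`, `Z ∈ A^m(M)` with `k > 0` and `l + m > 0`,
the function `(∇_X η)(Y, Z) = (∇_X ω^(t))(Y ∧ Z)`, `t = k + l + m - 1`, vanishes. -/
def IsParallel [IsManifold (𝓡 n) ∞ M] (η : AssocForm n M) (D : HigherConnection n M) : Prop :=
  ∀ (k l m t : ℕ) (X Y Z : MVF n M), X.HasDegree k → Y.HasDegree l → Z.HasDegree m →
    0 < k → 0 < l + m → t + 1 = k + l + m →
    ∀ p : M, D.covForm k t X (η.component t) (Y * Z) p = 0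

end AssocForm

end Manifold

end HigherConn

end

/-! In a chart, the flat operator `∑ᵢ ±(dxⁱ ⌟ X) ∧ ∂ᵢY` satisfies all axioms of a higher connection,
and its graded antisymmetrization is exactly the coordinate formula of the Schouten bracket, so its
torsion vanishes. It only fails to preserve the forms. For `ω` of degree `t`, parallelism means
`ω(∇_X Y) = ±(d i_Y ω)(X)`, and by the product rule the flat operator misses the term `∑ᵢ
(∂ᵢω)(±(dxⁱ ⌟ X) ∧ Y)`.

Since `ω` vanishes nowhere, there is a smooth local multivector `u` of degree `t` with `ω(u) = 1`;
adding the missing number times `u` repairs parallelism (`apply_locCov`). Forms of different degrees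
do not interfere, because `ω` kills the multivectors `u` of the other degrees. The correction is
linear over functions, so the Leibniz rules survive, and it sees only the part of `Y` of positive
degree, so `∇_X f = [X, f]` survives too. If `X ∧ Y = 0`, contracting this equation with `dxⁱ` shows
that the correction is graded symmetric and drops out of the torsion (`corrCoeff_torsion`). For two
vector fields the correction would have degree `1`, and it is absent because the component of degree
`1` is zero (`locCov_torsion_one`).

All conditions on `∇` are affine, with right-hand sides `[X, f]`, `[X, Y]` and `(d i_Y ω)(X)` that
do not depend on the chart. Hence the chart connections may be averaged with a partition of unity
(`glueAt_eq`, `apply_glueAt`). Independence of the chart is the naturality of the two coordinate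
formulas (`schoutenLocal_push`, `dLocal_pull`), where the second derivatives of the coordinate
change cancel by symmetry of the Hessian.

A multisymplectic form of positive degree cannot vanish at a point unless the tangent space there is
zero, which reduces the second claim to the first. -/

noncomputable section

namespace HigherConn

section

/-! ## Multilinear algebra in `∧^• ℝⁿ` -/

/-- The exterior algebra of the model space. -/
abbrev Ext (n : ℕ) : Type := ExteriorAlgebra ℝ (Model n)

/-- The grade involution of `∧^• ℝⁿ`. -/
abbrev gradeInv {n : ℕ} : Ext n →ₐ[ℝ] Ext n :=
  CliffordAlgebra.involute (Q := (0 : QuadraticForm ℝ (Model n)))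

/-- Contraction with a covector, as a linear map. -/
abbrev ctr {n : ℕ} (d : Module.Dual ℝ (Model n)) : Ext n →ₗ[ℝ] Ext n :=
  CliffordAlgebra.contractLeft (Q := (0 : QuadraticForm ℝ (Model n))) d

variable {n : ℕ}

theorem contr_eq (i : Fin n) (x : Ext n) : contr i x = ctr ((stdBasis n).coord i) x := rfl

theorem ext_induction {C : Ext n → Prop} (x : Ext n)
    (algebraMap : ∀ r : ℝ, C (algebraMap ℝ (Ext n) r))
    (add : ∀ x y, C x → C y → C (x + y))
    (ι_mul : ∀ x (v : Model n), C x → C (ExteriorAlgebra.ι ℝ v * x)) : C x :=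
  CliffordAlgebra.left_induction (Q := (0 : QuadraticForm ℝ (Model n))) (P := C) algebraMap add
    ι_mul x

theorem gradeInv_ι (v : Model n) :
    gradeInv (ExteriorAlgebra.ι ℝ v) = -ExteriorAlgebra.ι ℝ v :=
  CliffordAlgebra.involute_ι v

theorem ctr_ι_mul (d : Module.Dual ℝ (Model n)) (v : Model n) (x : Ext n) :
    ctr d (ExteriorAlgebra.ι ℝ v * x) = d v • x - ExteriorAlgebra.ι ℝ v * ctr d x :=
  CliffordAlgebra.contractLeft_ι_mul d v x

theorem ctr_algebraMap (d : Module.Dual ℝ (Model n)) (r : ℝ) :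
    ctr d (algebraMap ℝ (Ext n) r) = 0 :=
  CliffordAlgebra.contractLeft_algebraMap (0 : QuadraticForm ℝ (Model n)) d r

/-- The graded Leibniz rule. Applied to a product that vanishes, it yields the symmetry of the
correction term. -/
theorem ctr_mul (d : Module.Dual ℝ (Model n)) (x y : Ext n) :
    ctr d (x * y) = ctr d x * y + gradeInv x * ctr d y := by
  induction x using ext_induction with
  | algebraMap r =>
    rw [ctr_algebraMap, zero_mul, zero_add, AlgHom.commutes, ← Algebra.smul_def,
      ← Algebra.smul_def, map_smul]
  | add a b ha hb => simp only [add_mul, map_add, ha, hb]; abel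
  | ι_mul x v h =>
    rw [mul_assoc, ctr_ι_mul, ctr_ι_mul, h, map_mul, gradeInv_ι]
    simp only [mul_add, sub_mul, smul_mul_assoc, neg_mul, mul_assoc]
    abel

/-- Moving a vector past `x` costs one sign per factor; phrased with the grade involution, this
needs no homogeneity of `x`. -/
theorem ι_mul_eq (v : Model n) (x : Ext n) :
    ExteriorAlgebra.ι ℝ v * x = gradeInv x * ExteriorAlgebra.ι ℝ v := by
  induction x using ext_induction with
  | algebraMap r => rw [AlgHom.commutes]; exact (Algebra.commutes r _).symm
  | add a b ha hb => simp only [mul_add, map_add, add_mul, ha, hb]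
  | ι_mul x w h =>
    have hs : ExteriorAlgebra.ι ℝ v * ExteriorAlgebra.ι ℝ w
        = -(ExteriorAlgebra.ι ℝ w * ExteriorAlgebra.ι ℝ v) :=
      eq_neg_of_add_eq_zero_left (ExteriorAlgebra.ι_add_mul_swap v w)
    rw [← mul_assoc, hs, neg_mul, mul_assoc, h, map_mul, gradeInv_ι]
    simp only [neg_mul, mul_assoc]

theorem gradeInv_map (A : Model n →ₗ[ℝ] Model n) (x : Ext n) :
    gradeInv (ExteriorAlgebra.map A x) = ExteriorAlgebra.map A (gradeInv x) := by
  induction x using ext_induction with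
  | algebraMap r => simp only [AlgHom.commutes]
  | add a b ha hb => simp only [map_add, ha, hb]
  | ι_mul x w h =>
    simp only [map_mul, h, gradeInv_ι, ExteriorAlgebra.map_apply_ι, map_neg]

theorem ctr_map (A : Model n →ₗ[ℝ] Model n) (d : Module.Dual ℝ (Model n)) (x : Ext n) :
    ctr d (ExteriorAlgebra.map A x) = ExteriorAlgebra.map A (ctr (d ∘ₗ A) x) := by
  induction x using ext_induction with
  | algebraMap r => simp only [AlgHom.commutes, ctr_algebraMap, map_zero]
  | add a b ha hb => simp only [map_add, ha, hb]
  | ι_mul x w h =>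
    rw [map_mul, ExteriorAlgebra.map_apply_ι, ctr_ι_mul, ctr_ι_mul, h, map_sub, map_smul, map_mul,
      ExteriorAlgebra.map_apply_ι]
    rfl

theorem dual_eq_sum (d : Module.Dual ℝ (Model n)) :
    d = ∑ k, d (stdBasis n k) • (stdBasis n).coord k := by
  refine (stdBasis n).ext fun j => ?_
  simp

/-- Contractions commute with induced maps up to the transposed matrix. -/
theorem contr_map (A : Model n →ₗ[ℝ] Model n) (i : Fin n) (x : Ext n) :
    contr i (ExteriorAlgebra.map A x) =
      ∑ k, (stdBasis n).coord i (A (stdBasis n k)) • ExteriorAlgebra.map A (contr k x) := by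
  rw [contr_eq, ctr_map, dual_eq_sum ((stdBasis n).coord i ∘ₗ A)]
  simp only [map_sum, LinearMap.sum_apply, map_smul, LinearMap.smul_apply, contr_eq,
    LinearMap.comp_apply]

theorem sum_coord (v : Model n) : ∑ i, (stdBasis n).coord i v • stdBasis n i = v := by
  exact (stdBasis n).sum_repr v

/-- The canonical element `∑ eᵢ ⊗ eⁱ` is invariant under induced maps. -/
theorem sum_contr_map {F : Type*} [AddCommGroup F] [Module ℝ F]
    (B : Model n →ₗ[ℝ] Ext n →ₗ[ℝ] F) (A : Model n →ₗ[ℝ] Model n) (x : Ext n) :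
    ∑ i, B (stdBasis n i) (contr i (ExteriorAlgebra.map A x)) =
      ∑ k, B (A (stdBasis n k)) (ExteriorAlgebra.map A (contr k x)) := by
  simp only [contr_map, map_sum, map_smul]
  rw [Finset.sum_comm]
  refine Finset.sum_congr rfl fun k _ => ?_
  conv_rhs => rw [← sum_coord (A (stdBasis n k))]
  simp only [map_sum, map_smul, LinearMap.sum_apply, LinearMap.smul_apply]

/-! ### Degrees -/

theorem mem_deg_induction {C : ℕ → Ext n → Prop} {k : ℕ} {x : Ext n}
    (hx : x ∈ ⋀[ℝ]^k (Model n))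
    (algebraMap : ∀ r : ℝ, C 0 (algebraMap ℝ (Ext n) r))
    (add : ∀ k x y, C k x → C k y → C k (x + y))
    (ι_mul : ∀ k x (v : Model n), x ∈ ⋀[ℝ]^k (Model n) → C k x →
      C (k + 1) (ExteriorAlgebra.ι ℝ v * x)) : C k x := by
  refine Submodule.pow_induction_on_left' (M := LinearMap.range (ExteriorAlgebra.ι ℝ))
    (C := fun k x _ => C k x) algebraMap (fun x y i _ _ hx hy => add i x y hx hy) ?_ hx
  rintro m ⟨v, rfl⟩ i x hx hC
  exact ι_mul i x v hx hC

theorem ι_mul_mem {k : ℕ} (v : Model n) {x : Ext n} (hx : x ∈ ⋀[ℝ]^k (Model n)) :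
    ExteriorAlgebra.ι ℝ v * x ∈ ⋀[ℝ]^(k + 1) (Model n) := by
  change _ ∈ (LinearMap.range (ExteriorAlgebra.ι ℝ)) ^ (k + 1)
  rw [pow_succ']
  exact Submodule.mul_mem_mul ⟨v, rfl⟩ hx

theorem mul_mem_deg {k l : ℕ} {x y : Ext n} (hx : x ∈ ⋀[ℝ]^k (Model n))
    (hy : y ∈ ⋀[ℝ]^l (Model n)) : x * y ∈ ⋀[ℝ]^(k + l) (Model n) :=
  SetLike.mul_mem_graded hx hy

theorem algebraMap_mem_deg (r : ℝ) : algebraMap ℝ (Ext n) r ∈ ⋀[ℝ]^0 (Model n) :=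
  SetLike.algebraMap_mem_graded _ r

theorem gradeInv_of_mem {k : ℕ} {x : Ext n} (hx : x ∈ ⋀[ℝ]^k (Model n)) :
    gradeInv x = (-1 : ℝ) ^ k • x := by
  refine mem_deg_induction (C := fun k x => gradeInv x = (-1 : ℝ) ^ k • x) hx ?_ ?_ ?_
  · intro r; simp
  · intro k x y hx hy; rw [map_add, hx, hy, smul_add]
  · intro k x v _ h
    rw [map_mul, h, gradeInv_ι, pow_succ]
    simp

theorem ctr_mem {k : ℕ} (d : Module.Dual ℝ (Model n)) {x : Ext n}
    (hx : x ∈ ⋀[ℝ]^(k + 1) (Model n)) : ctr d x ∈ ⋀[ℝ]^k (Model n) := by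
  have := mem_deg_induction (C := fun k x => ∀ j, k = j + 1 → ctr d x ∈ ⋀[ℝ]^j (Model n)) hx
    ?_ ?_ ?_ k rfl
  · exact this
  · intro r j hj; omega
  · intro k x y hx hy j hj
    rw [map_add]
    exact add_mem (hx j hj) (hy j hj)
  · intro k x v hx h j hj
    obtain rfl : k = j := by omega
    rw [ctr_ι_mul]
    refine sub_mem (Submodule.smul_mem _ _ hx) ?_
    -- For `k = 0` the induction hypothesis is vacuous; there `x` is a scalar, and its contraction
    -- is zero.
    cases k with
    | zero =>
      obtain ⟨r, rfl⟩ : ∃ r, algebraMap ℝ (Ext n) r = x := by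
        have : x ∈ (1 : Submodule ℝ (Ext n)) := by simpa using hx
        exact Submodule.mem_one.1 this
      rw [ctr_algebraMap, mul_zero]
      exact zero_mem _
    | succ k => exact ι_mul_mem v (h k rfl)

theorem exists_algebraMap_of_mem {x : Ext n} (hx : x ∈ ⋀[ℝ]^0 (Model n)) :
    ∃ r, algebraMap ℝ (Ext n) r = x := by
  have : x ∈ (1 : Submodule ℝ (Ext n)) := by simpa using hx
  exact Submodule.mem_one.1 this

theorem ctr_of_mem_zero (d : Module.Dual ℝ (Model n)) {x : Ext n}
    (hx : x ∈ ⋀[ℝ]^0 (Model n)) : ctr d x = 0 := by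
  obtain ⟨r, rfl⟩ := exists_algebraMap_of_mem hx
  exact ctr_algebraMap d r

/-- Graded commutativity of the exterior product. -/
theorem mul_comm_deg {k l : ℕ} {x y : Ext n} (hx : x ∈ ⋀[ℝ]^k (Model n))
    (hy : y ∈ ⋀[ℝ]^l (Model n)) : x * y = (-1 : ℝ) ^ (k * l) • (y * x) := by
  refine mem_deg_induction (C := fun k x => x * y = (-1 : ℝ) ^ (k * l) • (y * x)) hx ?_ ?_ ?_
  · intro r; rw [Algebra.commutes]; simp
  · intro k a b ha hb; rw [add_mul, mul_add, ha, hb, smul_add]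
  · intro k x v _ h
    rw [mul_assoc, h, mul_smul_comm, ← mul_assoc, ι_mul_eq, gradeInv_of_mem hy, smul_mul_assoc,
      smul_mul_assoc, smul_smul, ← pow_add, mul_assoc]
    congr 2
    ring

theorem map_mem_deg {V W : Type*} [AddCommGroup V] [Module ℝ V] [AddCommGroup W] [Module ℝ W]
    (A : V →ₗ[ℝ] W) {k : ℕ} {x : ExteriorAlgebra ℝ V} (hx : x ∈ ⋀[ℝ]^k V) :
    ExteriorAlgebra.map A x ∈ ⋀[ℝ]^k W := by
  have h : (⋀[ℝ]^k V).map (ExteriorAlgebra.map A).toLinearMap ≤ ⋀[ℝ]^k W := by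
    change ((LinearMap.range (ExteriorAlgebra.ι ℝ)) ^ k).map _ ≤ _
    rw [Submodule.map_pow]
    refine pow_le_pow_left' ?_ k
    rintro _ ⟨_, ⟨v, rfl⟩, rfl⟩
    exact ⟨A v, (ExteriorAlgebra.map_apply_ι A v).symm⟩
  exact h ⟨x, hx, rfl⟩

theorem extBasis_mem (S : Finset (Fin n)) : extBasis n S ∈ ⋀[ℝ]^S.card (Model n) := by
  have := ExteriorAlgebra.basis_eq_coe_basis (stdBasis n)
    (⟨S, rfl⟩ : Set.powersetCard (Fin n) S.card)
  rw [extBasis]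
  change (stdBasis n).ExteriorAlgebra S ∈ _
  rw [show (stdBasis n).ExteriorAlgebra S = _ from this]
  exact Subtype.prop _

/-- Projection to the degree `k` part. -/
abbrev degProj (k : ℕ) : Ext n →ₗ[ℝ] Ext n :=
  GradedAlgebra.proj (fun i => ⋀[ℝ]^i (Model n)) k

theorem degProj_of_mem {k : ℕ} {x : Ext n} (hx : x ∈ ⋀[ℝ]^k (Model n)) (l : ℕ) :
    degProj l x = if k = l then x else 0 := by
  split_ifs with h
  · subst h
    exact DirectSum.decompose_of_mem_same (fun i : ℕ => ⋀[ℝ]^i (Model n)) hx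
  · exact DirectSum.decompose_of_mem_ne (fun i : ℕ => ⋀[ℝ]^i (Model n)) hx h

theorem repr_degProj (k : ℕ) (x : Ext n) (S : Finset (Fin n)) :
    (extBasis n).repr (degProj k x) S = if S.card = k then (extBasis n).repr x S else 0 := by
  conv_lhs => rw [← (extBasis n).sum_repr x]
  simp only [map_sum, map_smul, degProj_of_mem (extBasis_mem _), Finsupp.finsetSum_apply,
    apply_ite, map_zero, Module.Basis.repr_self]
  rw [Finset.sum_eq_single S]
  · split_ifs with h <;> simp
  · intro T _ hT
    split_ifs with h <;> simp [hT]
  · simp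

theorem mem_deg_iff {k : ℕ} {x : Ext n} :
    x ∈ ⋀[ℝ]^k (Model n) ↔ ∀ S : Finset (Fin n), S.card ≠ k → (extBasis n).repr x S = 0 := by
  constructor
  · intro hx S hS
    have := repr_degProj k x S
    rwa [degProj_of_mem hx, if_pos rfl, if_neg hS] at this
  · intro h
    rw [← (extBasis n).sum_repr x]
    refine Submodule.sum_mem _ fun S _ => ?_
    by_cases hS : S.card = k
    · exact Submodule.smul_mem _ _ (hS ▸ extBasis_mem S)
    · rw [h S hS, zero_smul]; exact zero_mem _

theorem eq_zero_of_mem_of_lt {k : ℕ} (hk : n < k) {x : Ext n} (hx : x ∈ ⋀[ℝ]^k (Model n)) :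
    x = 0 := by
  apply (extBasis n).repr.injective
  ext S
  rw [map_zero, Finsupp.zero_apply]
  refine mem_deg_iff.1 hx S fun hS => ?_
  have := S.card_le_univ
  rw [Fintype.card_fin] at this
  omega

end

section

/-! ## Calculus in `∧^• ℝⁿ` -/

variable {n : ℕ}

/-- In finite dimension the choice of norm is immaterial. The norm of the coordinate vector makes
smoothness of a multivector-valued map the same as smoothness of its coefficients. -/
instance extNormedAddCommGroup : NormedAddCommGroup (Ext n) :=
  NormedAddCommGroup.induced (Ext n) (Finset (Fin n) → ℝ) (extBasis n).equivFun
    (extBasis n).equivFun.injective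

instance extNormedSpace : NormedSpace ℝ (Ext n) :=
  NormedSpace.induced ℝ (Ext n) (Finset (Fin n) → ℝ) (extBasis n).equivFun.toLinearMap

instance extFiniteDimensional : FiniteDimensional ℝ (Ext n) :=
  (extBasis n).finiteDimensional_of_finite

/-- A covector of `∧^• ℝⁿ` in coordinates. -/
def dualCoords (n : ℕ) : Module.Dual ℝ (Ext n) ≃ₗ[ℝ] (Finset (Fin n) → ℝ) :=
  ((extBasis n).constr ℝ).symm

instance extDualNormedAddCommGroup : NormedAddCommGroup (Module.Dual ℝ (Ext n)) :=
  NormedAddCommGroup.induced (Module.Dual ℝ (Ext n)) (Finset (Fin n) → ℝ) (dualCoords n)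
    (dualCoords n).injective

instance extDualNormedSpace : NormedSpace ℝ (Module.Dual ℝ (Ext n)) :=
  NormedSpace.induced ℝ (Module.Dual ℝ (Ext n)) (Finset (Fin n) → ℝ) (dualCoords n).toLinearMap

instance extDualFiniteDimensional : FiniteDimensional ℝ (Module.Dual ℝ (Ext n)) :=
  (dualCoords n).symm.finiteDimensional

/-! ### Differentiability under linear and bilinear maps. -/

section Linear

variable {E F G : Type*} [NormedAddCommGroup E] [NormedSpace ℝ E] [FiniteDimensional ℝ E]
  [NormedAddCommGroup F] [NormedSpace ℝ F] [FiniteDimensional ℝ F]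
  [NormedAddCommGroup G] [NormedSpace ℝ G]
  {H : Type*} [NormedAddCommGroup H] [NormedSpace ℝ H]

/-- A bilinear map on finite dimensional spaces, as a continuous bilinear map. -/
def bilinCLM (B : E →ₗ[ℝ] F →ₗ[ℝ] G) : E →L[ℝ] F →L[ℝ] G :=
  LinearMap.toContinuousLinearMap
    ((LinearMap.toContinuousLinearMap (𝕜 := ℝ) (E := F) (F' := G)).toLinearMap ∘ₗ B)

theorem _root_.HasFDerivAt.linear_comp {f : H → E} {f' : H →L[ℝ] E} {x : H}
    (hf : HasFDerivAt f f' x) (L : E →ₗ[ℝ] G) :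
    HasFDerivAt (fun z => L (f z)) ((LinearMap.toContinuousLinearMap L).comp f') x :=
  (LinearMap.toContinuousLinearMap L).hasFDerivAt.comp x hf

theorem _root_.HasFDerivAt.bilin {f : H → E} {f' : H →L[ℝ] E} {g : H → F} {g' : H →L[ℝ] F} {x : H}
    (B : E →ₗ[ℝ] F →ₗ[ℝ] G) (hf : HasFDerivAt f f' x) (hg : HasFDerivAt g g' x) :
    HasFDerivAt (fun z => B (f z) (g z))
      ((bilinCLM B).precompR H (f x) g' + (bilinCLM B).precompL H f' (g x)) x :=
  (bilinCLM B).hasFDerivAt_of_bilinear hf hg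

theorem _root_.ContDiffAt.linear_comp {f : H → E} {x : H} {m : WithTop ℕ∞}
    (hf : ContDiffAt ℝ m f x) (L : E →ₗ[ℝ] G) : ContDiffAt ℝ m (fun z => L (f z)) x :=
  (LinearMap.toContinuousLinearMap L).contDiff.contDiffAt.comp x hf

theorem _root_.ContDiffAt.bilin {f : H → E} {g : H → F} {x : H} {m : WithTop ℕ∞}
    (B : E →ₗ[ℝ] F →ₗ[ℝ] G) (hf : ContDiffAt ℝ m f x) (hg : ContDiffAt ℝ m g x) :
    ContDiffAt ℝ m (fun z => B (f z) (g z)) x :=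
  (bilinCLM B).isBoundedBilinearMap.contDiff.contDiffAt.comp x (hf.prodMk hg)

end Linear

theorem contDiffAt_ext_iff {P : Model n → Ext n} {y : Model n} {m : WithTop ℕ∞} :
    ContDiffAt ℝ m P y ↔
      ∀ S : Finset (Fin n), ContDiffAt ℝ m (fun z => (extBasis n).repr (P z) S) y := by
  constructor
  · intro h S
    exact h.linear_comp ((extBasis n).coord S)
  · intro h
    have h2 : ContDiffAt ℝ m (fun z => ∑ S, (extBasis n).repr (P z) S • extBasis n S) y :=
      ContDiffAt.sum fun S _ => (h S).smul contDiffAt_const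
    simpa only [(extBasis n).sum_repr] using h2

theorem contDiffAt_dual_iff {β : Model n → Module.Dual ℝ (Ext n)} {y : Model n}
    {m : WithTop ℕ∞} :
    ContDiffAt ℝ m β y ↔
      ∀ S : Finset (Fin n), ContDiffAt ℝ m (fun z => β z (extBasis n S)) y := by
  constructor
  · intro h S
    exact h.linear_comp (LinearMap.applyₗ (extBasis n S))
  · intro h
    have h2 : ContDiffAt ℝ m (fun z => (dualCoords n).symm fun S => β z (extBasis n S)) y :=
      (contDiffAt_pi.2 h).linear_comp (dualCoords n).symm.toLinearMap
    refine h2.congr_of_eventuallyEq (Filter.Eventually.of_forall fun z => ?_)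
    refine (extBasis n).ext fun S => ?_
    simp [dualCoords]

/-- Differentiability matters here: otherwise the right-hand side takes its default value `0`, while
single coefficients may still have nonzero derivatives. -/
theorem partialMV_eq {P : Model n → Ext n} {y : Model n} (hP : DifferentiableAt ℝ P y)
    (i : Fin n) : partialMV P i y = fderiv ℝ P y (stdBasis n i) := by
  rw [partialMV]
  conv_rhs => rw [← (extBasis n).sum_repr (fderiv ℝ P y (stdBasis n i))]
  refine Finset.sum_congr rfl fun S _ => ?_
  have := (hP.hasFDerivAt.linear_comp ((extBasis n).coord S)).fderiv
  simp only [Module.Basis.coord_apply] at this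
  rw [this]
  rfl

/-- Derivative of the wedge product. -/
theorem hasFDerivAt_ext_mul {H : Type*} [NormedAddCommGroup H] [NormedSpace ℝ H]
    {P Q : H → Ext n} {P' Q' : H →L[ℝ] Ext n} {y : H}
    (hP : HasFDerivAt P P' y) (hQ : HasFDerivAt Q Q' y) :
    HasFDerivAt (fun z => P z * Q z)
      ((bilinCLM (LinearMap.mul ℝ (Ext n))).precompR H (P y) Q'
        + (bilinCLM (LinearMap.mul ℝ (Ext n))).precompL H P' (Q y)) y :=
  HasFDerivAt.bilin (LinearMap.mul ℝ (Ext n)) hP hQ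

theorem contDiffAt_ext_mul {H : Type*} [NormedAddCommGroup H] [NormedSpace ℝ H] {m : WithTop ℕ∞}
    {P Q : H → Ext n} {y : H} (hP : ContDiffAt ℝ m P y) (hQ : ContDiffAt ℝ m Q y) :
    ContDiffAt ℝ m (fun z => P z * Q z) y :=
  ContDiffAt.bilin (LinearMap.mul ℝ (Ext n)) hP hQ

/-! ### The induced map on `∧^•` as a function of the linear map -/

/-- The differential of `A ↦ ∧^•A` at `A` in direction `B`. -/
def extVariation (A B : Model n →ₗ[ℝ] Model n) (x : Ext n) : Ext n :=
  ∑ j, ExteriorAlgebra.ι ℝ (B (stdBasis n j)) * ExteriorAlgebra.map A (contr j x)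

/-- This is the product rule for `A ↦ A v ∧ (∧^•A) x` in direction `B`. The sign from contracting
past `v` cancels the sign from exchanging the vectors `A v` and `B eᵢ`. -/
theorem extVariation_ι_mul (A B : Model n →ₗ[ℝ] Model n) (v : Model n) (x : Ext n) :
    extVariation A B (ExteriorAlgebra.ι ℝ v * x) =
      ExteriorAlgebra.ι ℝ (A v) * extVariation A B x
        + ExteriorAlgebra.ι ℝ (B v) * ExteriorAlgebra.map A x := by
  simp only [extVariation, contr_eq, ctr_ι_mul, map_sub, map_smul, map_mul,
    ExteriorAlgebra.map_apply_ι, mul_sub, Finset.sum_sub_distrib, Finset.mul_sum, mul_smul_comm,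
    ← smul_mul_assoc]
  rw [← Finset.sum_mul]
  conv_rhs => rw [← sum_coord v]
  simp only [map_sum, map_smul]
  have h : ∀ i, ExteriorAlgebra.ι ℝ (B (stdBasis n i)) * (ExteriorAlgebra.ι ℝ (A v) *
        ExteriorAlgebra.map A (ctr ((stdBasis n).coord i) x)) =
      -(ExteriorAlgebra.ι ℝ (A v) * (ExteriorAlgebra.ι ℝ (B (stdBasis n i)) *
        ExteriorAlgebra.map A (ctr ((stdBasis n).coord i) x))) := by
    intro i
    rw [← mul_assoc, ← mul_assoc, ← neg_mul,
      eq_neg_of_add_eq_zero_left (ExteriorAlgebra.ι_add_mul_swap (B (stdBasis n i)) (A v))]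
  simp only [h, Finset.sum_neg_distrib, sub_neg_eq_add]
  have hA : ∑ j, (stdBasis n).coord j v • ExteriorAlgebra.ι ℝ (A (stdBasis n j))
      = ExteriorAlgebra.ι ℝ (A v) := by
    conv_rhs => rw [← sum_coord v]
    simp only [map_sum, map_smul]
  rw [hA, add_comm]

theorem hasFDerivAt_extMap (x : Ext n) (A : Model n →L[ℝ] Model n) :
    ∃ L : (Model n →L[ℝ] Model n) →L[ℝ] Ext n,
      HasFDerivAt (fun C : Model n →L[ℝ] Model n => ExteriorAlgebra.map C.toLinearMap x) L A ∧
      ∀ B : Model n →L[ℝ] Model n, L B = extVariation A.toLinearMap B.toLinearMap x := by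
  induction x using ext_induction with
  | algebraMap r =>
    refine ⟨0, ?_, fun B => ?_⟩
    · simp only [AlgHom.commutes]
      exact hasFDerivAt_const _ _
    · simp [extVariation, contr_eq]
  | add x y hx hy =>
    obtain ⟨L, hL, hL'⟩ := hx
    obtain ⟨K, hK, hK'⟩ := hy
    refine ⟨L + K, ?_, fun B => ?_⟩
    · simp only [map_add]
      exact hL.add hK
    · simp [extVariation, contr_eq, hL', hK', mul_add, Finset.sum_add_distrib]
  | ι_mul x v hx =>
    obtain ⟨L, hL, hL'⟩ := hx
    have h1 : HasFDerivAt (fun C : Model n →L[ℝ] Model n => ExteriorAlgebra.ι ℝ (C v))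
        ((LinearMap.toContinuousLinearMap (ExteriorAlgebra.ι ℝ (M := Model n))).comp
          (ContinuousLinearMap.apply ℝ (Model n) v)) A :=
      ((LinearMap.toContinuousLinearMap (ExteriorAlgebra.ι ℝ (M := Model n))).comp
          (ContinuousLinearMap.apply ℝ (Model n) v)).hasFDerivAt
    have h2 := hasFDerivAt_ext_mul h1 hL
    simp only [← ExteriorAlgebra.map_apply_ι, ← ContinuousLinearMap.coe_coe, ← map_mul] at h2
    refine ⟨_, h2, fun B => ?_⟩
    rw [extVariation_ι_mul, ← hL', ← ExteriorAlgebra.map_apply_ι]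
    rfl

theorem contDiff_extMap (x : Ext n) {m : WithTop ℕ∞} :
    ContDiff ℝ m (fun C : Model n →L[ℝ] Model n => ExteriorAlgebra.map C.toLinearMap x) := by
  induction x using ext_induction with
  | algebraMap r => simp only [AlgHom.commutes]; exact contDiff_const
  | add x y hx hy => simp only [map_add]; exact hx.add hy
  | ι_mul x v hx =>
    simp only [map_mul, ExteriorAlgebra.map_apply_ι]
    refine contDiff_iff_contDiffAt.2 fun A => contDiffAt_ext_mul ?_ hx.contDiffAt
    exact ((LinearMap.toContinuousLinearMap (ExteriorAlgebra.ι ℝ (M := Model n))).comp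
      (ContinuousLinearMap.apply ℝ (Model n) v)).contDiff.contDiffAt

theorem contDiffAt_extMap {H : Type*} [NormedAddCommGroup H] [NormedSpace ℝ H] {m : WithTop ℕ∞}
    {A : H → Model n →L[ℝ] Model n} {P : H → Ext n} {y : H} (hA : ContDiffAt ℝ m A y)
    (hP : ContDiffAt ℝ m P y) :
    ContDiffAt ℝ m (fun z => ExteriorAlgebra.map (A z).toLinearMap (P z)) y := by
  have h : ∀ z, ExteriorAlgebra.map (A z).toLinearMap (P z) =
      ∑ S, (extBasis n).repr (P z) S • ExteriorAlgebra.map (A z).toLinearMap (extBasis n S) := by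
    intro z
    conv_lhs => rw [← (extBasis n).sum_repr (P z)]
    simp only [map_sum, map_smul]
  simp only [h]
  refine ContDiffAt.sum fun S _ => ContDiffAt.fun_smul ?_ ?_
  · exact hP.linear_comp ((extBasis n).coord S)
  · exact (contDiff_extMap (extBasis n S)).contDiffAt.comp y hA

/-- Product rule for `z ↦ ∧^•(A z) (P z)`. -/
theorem hasFDerivAt_extMap_apply {A : Model n → Model n →L[ℝ] Model n} {P : Model n → Ext n}
    {y : Model n} (hA : DifferentiableAt ℝ A y) (hP : DifferentiableAt ℝ P y) :
    ∃ L : Model n →L[ℝ] Ext n,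
      HasFDerivAt (fun z => ExteriorAlgebra.map (A z).toLinearMap (P z)) L y ∧
      ∀ v, L v = extVariation (A y).toLinearMap (fderiv ℝ A y v).toLinearMap (P y)
        + ExteriorAlgebra.map (A y).toLinearMap (fderiv ℝ P y v) := by
  have h : ∀ z, ExteriorAlgebra.map (A z).toLinearMap (P z) =
      ∑ S, (extBasis n).repr (P z) S • ExteriorAlgebra.map (A z).toLinearMap (extBasis n S) := by
    intro z
    conv_lhs => rw [← (extBasis n).sum_repr (P z)]
    simp only [map_sum, map_smul]
  choose L hL hL' using fun S => hasFDerivAt_extMap (extBasis n S) (A y)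
  have hc := fun S : Finset (Fin n) => hP.hasFDerivAt.linear_comp ((extBasis n).coord S)
  have hm := fun S : Finset (Fin n) => (hL S).comp y hA.hasFDerivAt
  have hd := (HasFDerivAt.fun_sum (u := Finset.univ) fun S _ =>
    (hc S).fun_smul (hm S)).congr_of_eventuallyEq (Filter.Eventually.of_forall h)
  refine ⟨_, hd, fun v => ?_⟩
  have e1 : ExteriorAlgebra.map (A y).toLinearMap (fderiv ℝ P y v) =
      ∑ S, (extBasis n).repr (fderiv ℝ P y v) S •
        ExteriorAlgebra.map (A y).toLinearMap (extBasis n S) := by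
    conv_lhs => rw [← (extBasis n).sum_repr (fderiv ℝ P y v)]
    simp only [map_sum, map_smul]
  have e2 : extVariation (A y).toLinearMap (fderiv ℝ A y v).toLinearMap (P y) =
      ∑ S, (extBasis n).repr (P y) S •
        extVariation (A y).toLinearMap (fderiv ℝ A y v).toLinearMap (extBasis n S) := by
    conv_lhs => rw [← (extBasis n).sum_repr (P y)]
    simp only [extVariation, contr_eq, map_sum, map_smul, Finset.mul_sum, Finset.smul_sum,
      mul_smul_comm]
    exact Finset.sum_comm
  rw [e1, e2, ← Finset.sum_add_distrib]
  simp only [_root_.sum_apply]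
  refine Finset.sum_congr rfl fun S _ => ?_
  rw [← hL']
  rfl

end

section

/-! ## Behaviour of the local formulas under coordinate changes -/

variable {n : ℕ}

/-- `P'` is the push-forward of `P` by `g`, near `y`. -/
def PushMV (g : Model n → Model n) (y : Model n) (P P' : Model n → Ext n) : Prop :=
  ∀ᶠ z in 𝓝 y, P' (g z) = ExteriorAlgebra.map (fderiv ℝ g z).toLinearMap (P z)

/-- `β` is the pull-back of `β'` by `g`, near `y`. -/
def PullForm (g : Model n → Model n) (y : Model n) (β β' : Model n → Module.Dual ℝ (Ext n)) :
    Prop :=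
  ∀ᶠ z in 𝓝 y, β z = β' (g z) ∘ₗ (ExteriorAlgebra.map (fderiv ℝ g z).toLinearMap).toLinearMap

/-- The second order term in the transformation law of partial derivatives. -/
def hessTerm (g : Model n → Model n) (y v : Model n) (x : Ext n) : Ext n :=
  extVariation (fderiv ℝ g y).toLinearMap (fderiv ℝ (fderiv ℝ g) y v).toLinearMap x

theorem differentiableAt_fderiv {g : Model n → Model n} {y : Model n}
    (hg : ContDiffAt ℝ ∞ g y) : DifferentiableAt ℝ (fderiv ℝ g) y :=
  (hg.fderiv_right (m := 1) (by norm_cast)).differentiableAt (by norm_num)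

theorem hess_symm {g : Model n → Model n} {y : Model n} (hg : ContDiffAt ℝ ∞ g y)
    (v w : Model n) : fderiv ℝ (fderiv ℝ g) y v w = fderiv ℝ (fderiv ℝ g) y w v :=
  hg.isSymmSndFDerivAt (by
    simp only [minSmoothness_of_isRCLikeNormedField]; norm_cast) v w

/-- Differentiating `P' ∘ g = ∧^•(Dg) P` gives one term from the variation of `Dg`, the Hessian
term, and one from the variation of `P`. -/
theorem fderiv_pushMV {g : Model n → Model n} {y : Model n} (hg : ContDiffAt ℝ ∞ g y)
    {P P' : Model n → Ext n} (h : PushMV g y P P') (hP : DifferentiableAt ℝ P y)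
    (hP' : DifferentiableAt ℝ P' (g y)) (v : Model n) :
    fderiv ℝ P' (g y) (fderiv ℝ g y v) = hessTerm g y v (P y)
      + ExteriorAlgebra.map (fderiv ℝ g y).toLinearMap (fderiv ℝ P y v) := by
  obtain ⟨L, hL, hL'⟩ := hasFDerivAt_extMap_apply (differentiableAt_fderiv hg) hP
  have h1 := hP'.hasFDerivAt.comp y (hg.differentiableAt (by simp)).hasFDerivAt
  have h2 := h1.congr_of_eventuallyEq (h.mono fun z hz => hz.symm)
  have h3 := congrArg (fun K => K v) (h2.unique hL)
  simpa [hL', hessTerm] using h3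

theorem fderiv_pullForm {g : Model n → Model n} {y : Model n} (hg : ContDiffAt ℝ ∞ g y)
    {β β' : Model n → Module.Dual ℝ (Ext n)} (h : PullForm g y β β')
    (hβ : DifferentiableAt ℝ β y) (hβ' : DifferentiableAt ℝ β' (g y)) (v : Model n) (x : Ext n) :
    fderiv ℝ β y v x = β' (g y) (hessTerm g y v x)
      + fderiv ℝ β' (g y) (fderiv ℝ g y v)
        (ExteriorAlgebra.map (fderiv ℝ g y).toLinearMap x) := by
  obtain ⟨L, hL, hL'⟩ := hasFDerivAt_extMap_apply (differentiableAt_fderiv hg)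
    (differentiableAt_const (c := x) (x := y))
  have h1 := hβ'.hasFDerivAt.comp y (hg.differentiableAt (by simp)).hasFDerivAt
  have h2 := HasFDerivAt.bilin (LinearMap.id : Module.Dual ℝ (Ext n) →ₗ[ℝ] Ext n →ₗ[ℝ] ℝ) h1 hL
  have h3 : HasFDerivAt (fun z => β z x) _ y := h2.congr_of_eventuallyEq (h.mono fun z hz => by
    change β z x = _
    rw [hz]; rfl)
  have h4 := hβ.hasFDerivAt.linear_comp
    (LinearMap.applyₗ x : Module.Dual ℝ (Ext n) →ₗ[ℝ] ℝ)
  have h5 := congrArg (fun K => K v) (h4.unique h3)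
  have h6 : L v = hessTerm g y v x := by rw [hL']; simp [hessTerm]
  rw [← h6]
  exact h5

/-- Naturality of the Schouten–Nijenhuis bracket. -/
theorem schoutenLocal_push {g : Model n → Model n} {y : Model n} (hg : ContDiffAt ℝ ∞ g y)
    {P P' Q Q' : Model n → Ext n} (h : PushMV g y P P') (hP : DifferentiableAt ℝ P y)
    (hP' : DifferentiableAt ℝ P' (g y)) (k : PushMV g y Q Q') (hQ : DifferentiableAt ℝ Q y)
    (hQ' : DifferentiableAt ℝ Q' (g y)) :
    schoutenLocal P' Q' (g y)
      = ExteriorAlgebra.map (fderiv ℝ g y).toLinearMap (schoutenLocal P Q y) := by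
  set A := (fderiv ℝ g y).toLinearMap with hA
  have e1 := sum_contr_map ((LinearMap.mul ℝ (Ext n)).flip.compl₁₂
    ((fderiv ℝ Q' (g y)).toLinearMap) (gradeInv (n := n)).toLinearMap) A (P y)
  have e2 := sum_contr_map ((LinearMap.mul ℝ (Ext n)).compl₁₂
    ((fderiv ℝ P' (g y)).toLinearMap) LinearMap.id) A (Q y)
  simp only [LinearMap.compl₁₂_apply, LinearMap.flip_apply, LinearMap.mul_apply',
    AlgHom.toLinearMap_apply, ContinuousLinearMap.coe_coe, LinearMap.id_apply] at e1 e2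
  have hPy : P' (g y) = ExteriorAlgebra.map A (P y) := h.self_of_nhds
  have hQy : Q' (g y) = ExteriorAlgebra.map A (Q y) := k.self_of_nhds
  simp only [schoutenLocal, partialMV_eq hP, partialMV_eq hP', partialMV_eq hQ, partialMV_eq hQ',
    hPy, hQy, map_sum, map_sub, map_mul]
  rw [Finset.sum_sub_distrib, e1, e2]
  have hP2 : ∀ v, fderiv ℝ P' (g y) (A v) = _ := fderiv_pushMV hg h hP hP'
  have hQ2 : ∀ v, fderiv ℝ Q' (g y) (A v) = _ := fderiv_pushMV hg k hQ hQ'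
  simp only [hP2, hQ2, mul_add, add_mul, Finset.sum_add_distrib, Finset.sum_sub_distrib,
    gradeInv_map]
  -- Both sides are double sums over the vectors `D²g(eᵢ, eⱼ)`. Moving this vector past the
  -- contraction of `P` turns one into the other with `i` and `j` exchanged, and `D²g` is symmetric.
  have key : ∑ i, ExteriorAlgebra.map A (gradeInv (contr i (P y)))
        * hessTerm g y (stdBasis n i) (Q y) =
      ∑ i, hessTerm g y (stdBasis n i) (P y) * ExteriorAlgebra.map A (contr i (Q y)) := by
    simp only [hessTerm, extVariation, ← hA, Finset.mul_sum, Finset.sum_mul, ← mul_assoc,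
      ← gradeInv_map, ← ι_mul_eq]
    rw [Finset.sum_comm]
    refine Finset.sum_congr rfl fun i _ => Finset.sum_congr rfl fun j _ => ?_
    rw [ContinuousLinearMap.coe_coe, ContinuousLinearMap.coe_coe, hess_symm hg]
  rw [key]
  abel

/-- The exterior derivative in coordinates, `(dβ)(x) = ∑ᵢ (∂ᵢβ)(dxⁱ ⌟ x)`. -/
def dLocal (β : Model n → Module.Dual ℝ (Ext n)) (y : Model n) (x : Ext n) : ℝ :=
  ∑ i, fderiv ℝ β y (stdBasis n i) (contr i x)

/-- Naturality of the exterior derivative. -/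
theorem dLocal_pull {g : Model n → Model n} {y : Model n} (hg : ContDiffAt ℝ ∞ g y)
    {β β' : Model n → Module.Dual ℝ (Ext n)} (h : PullForm g y β β')
    (hβ : DifferentiableAt ℝ β y) (hβ' : DifferentiableAt ℝ β' (g y)) (x : Ext n) :
    dLocal β y x = dLocal β' (g y) (ExteriorAlgebra.map (fderiv ℝ g y).toLinearMap x) := by
  set A := (fderiv ℝ g y).toLinearMap with hA
  have e1 := sum_contr_map (fderiv ℝ β' (g y)).toLinearMap A x
  simp only [ContinuousLinearMap.coe_coe] at e1
  simp only [dLocal, fderiv_pullForm hg h hβ hβ', ← hA]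
  rw [e1, Finset.sum_add_distrib]
  -- `D²g(eᵢ, eⱼ)` is symmetric in `i, j`, whereas the iterated contraction of `x` is antisymmetric,
  -- so the double sum equals its own negative.
  have key : ∑ i, hessTerm g y (stdBasis n i) (contr i x) = 0 := by
    have hs : ∑ i, hessTerm g y (stdBasis n i) (contr i x) =
        -∑ i, hessTerm g y (stdBasis n i) (contr i x) := by
      simp only [hessTerm, extVariation, ← hA]
      conv_lhs => rw [Finset.sum_comm]
      rw [← Finset.sum_neg_distrib]
      refine Finset.sum_congr rfl fun i _ => ?_
      rw [← Finset.sum_neg_distrib]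
      refine Finset.sum_congr rfl fun j _ => ?_
      rw [ContinuousLinearMap.coe_coe, ContinuousLinearMap.coe_coe, hess_symm hg, contr_eq,
        contr_eq, contr_eq, contr_eq, ctr, ctr, CliffordAlgebra.contractLeft_comm, map_neg,
        mul_neg]
    have h2 : (2 : ℝ) • ∑ i, hessTerm g y (stdBasis n i) (contr i x) = 0 := by
      rw [two_smul]
      nth_rewrite 1 [hs]
      exact neg_add_cancel _
    exact (smul_eq_zero.1 h2).resolve_left two_ne_zero
  rw [← map_sum (β' (g y)), key, map_zero, zero_add]
  rfl

/-- The degree `k` part of a covector, as a linear map into continuous alternating forms. -/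
def altPartL (n k : ℕ) : Module.Dual ℝ (Ext n) →ₗ[ℝ] Model n [⋀^Fin k]→L[ℝ] ℝ where
  toFun := altPart k
  map_add' _ _ := rfl
  map_smul' _ _ := rfl

/-- Contraction expands a decomposable multivector along its factors with alternating signs. This is
the bridge from `dLocal` to the alternating sum that defines `extDeriv`. -/
theorem sum_bilin_contr_ιMulti {F : Type*} [AddCommGroup F] [Module ℝ F] {k : ℕ}
    (B : Model n →ₗ[ℝ] Ext n →ₗ[ℝ] F) (v : Fin (k + 1) → Model n) :
    ∑ i, B (stdBasis n i) (contr i (ExteriorAlgebra.ιMulti ℝ (k + 1) v)) =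
      ∑ j : Fin (k + 1), (-1 : ℝ) ^ (j : ℕ) •
        B (v j) (ExteriorAlgebra.ιMulti ℝ k (j.removeNth v)) := by
  have hfirst : ∀ (B : Model n →ₗ[ℝ] Ext n →ₗ[ℝ] F) (w : Model n) (x : Ext n),
      ∑ i, B (stdBasis n i) (contr i (ExteriorAlgebra.ι ℝ w * x)) =
        B w x - ∑ i, B (stdBasis n i) (ExteriorAlgebra.ι ℝ w * contr i x) := by
    intro B w x
    simp only [contr_eq, ctr_ι_mul, map_sub, map_smul, Finset.sum_sub_distrib]
    congr 1
    conv_rhs => rw [← sum_coord w]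
    simp only [map_sum, map_smul, LinearMap.sum_apply, LinearMap.smul_apply]
  induction k generalizing B with
  | zero =>
    rw [ExteriorAlgebra.ιMulti_succ_apply, hfirst]
    simp [contr_eq]
  | succ k ih =>
    rw [ExteriorAlgebra.ιMulti_succ_apply, hfirst, Fin.sum_univ_succ]
    -- The first vector is absorbed into the second argument of `B`, which is why the induction
    -- generalizes over `B`.
    have := ih (B.compl₂ (LinearMap.mulLeft ℝ (ExteriorAlgebra.ι ℝ (v 0)))) (Matrix.vecTail v)
    simp only [LinearMap.compl₂_apply, LinearMap.mulLeft_apply] at this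
    rw [this, sub_eq_add_neg, ← Finset.sum_neg_distrib]
    congr 1
    · simp only [Fin.val_zero, pow_zero, one_smul]
      rfl
    · refine Finset.sum_congr rfl fun j _ => ?_
      rw [Fin.val_succ, pow_succ, mul_neg_one, neg_smul]
      congr 3
      rw [ExteriorAlgebra.ιMulti_succ_apply]
      congr 2
      funext l
      simp [Fin.removeNth, Matrix.vecTail]

theorem extDerivLocal_apply {β : Model n → Module.Dual ℝ (Ext n)} {y : Model n}
    (hβ : DifferentiableAt ℝ β y) (x : Ext n) : extDerivLocal β y x = dLocal β y x := by
  have hL : ∀ x, dLocal β y x =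
      (∑ i, fderiv ℝ β y (stdBasis n i) ∘ₗ ctr ((stdBasis n).coord i)) x := by
    intro x
    simp only [dLocal, LinearMap.sum_apply]
    rfl
  rw [hL]
  revert x
  rw [← LinearMap.ext_iff]
  refine ExteriorAlgebra.lhom_ext fun k => ?_
  ext v
  simp only [LinearMap.compAlternatingMap_apply, ← hL]
  rw [extDerivLocal, ExteriorAlgebra.liftAlternating_apply_ιMulti]
  cases k with
  | zero => simp [dLocal, contr_eq]
  | succ k =>
    have hd := hβ.hasFDerivAt.linear_comp (altPartL n k)
    have e1 : extDeriv (fun z => altPart k (β z)) y v = _ := extDeriv_apply hd.differentiableAt v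
    refine e1.trans ?_
    rw [dLocal]
    have := sum_bilin_contr_ιMulti (fderiv ℝ β y).toLinearMap v
    refine Eq.trans ?_ this.symm
    refine Finset.sum_congr rfl fun j _ => ?_
    have hj := (hβ.hasFDerivAt.linear_comp (LinearMap.applyₗ (ExteriorAlgebra.ιMulti ℝ k
      (j.removeNth v)) : Module.Dual ℝ (Ext n) →ₗ[ℝ] ℝ)).fderiv
    have hj' : fderiv ℝ (fun x => (altPartL n k) (β x) (j.removeNth v)) y (v j) =
        fderiv ℝ β y (v j) (ExteriorAlgebra.ιMulti ℝ k (j.removeNth v)) :=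
      congrArg (fun K => K (v j)) hj
    rw [hj']
    simp

end

section

/-! ## The higher connection in a chart -/

variable {n : ℕ}

/-- The part of positive degree. -/
def posPart (x : Ext n) : Ext n := x - degProj 0 x

theorem posPart_add (x y : Ext n) : posPart (x + y) = posPart x + posPart y := by
  simp only [posPart, map_add]; abel

theorem posPart_smul (r : ℝ) (x : Ext n) : posPart (r • x) = r • posPart x := by
  simp only [posPart, map_smul, smul_sub]

theorem posPart_of_mem {k : ℕ} {x : Ext n} (hx : x ∈ ⋀[ℝ]^k (Model n)) :
    posPart x = if k = 0 then 0 else x := by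
  rw [posPart, degProj_of_mem hx]
  split_ifs <;> simp

theorem posPart_mem {k : ℕ} {x : Ext n} (hx : x ∈ ⋀[ℝ]^k (Model n)) :
    posPart x ∈ ⋀[ℝ]^k (Model n) := by
  rw [posPart_of_mem hx]
  split_ifs
  · exact zero_mem _
  · exact hx

/-- A multivector on which the covector `β ≠ 0` takes the value `1`. -/
def unitMV (β : Module.Dual ℝ (Ext n)) : Ext n :=
  (∑ S, β (extBasis n S) ^ 2)⁻¹ • ∑ S, β (extBasis n S) • extBasis n S

theorem sum_sq_ne_zero {β : Module.Dual ℝ (Ext n)} (hβ : β ≠ 0) :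
    ∑ S, β (extBasis n S) ^ 2 ≠ 0 := by
  intro h
  rw [Finset.sum_eq_zero_iff_of_nonneg fun S _ => sq_nonneg _] at h
  refine hβ ((extBasis n).ext fun S => ?_)
  simpa using h S (Finset.mem_univ _)

theorem apply_unitMV {β : Module.Dual ℝ (Ext n)} (hβ : β ≠ 0) : β (unitMV β) = 1 := by
  rw [unitMV, map_smul, map_sum, smul_eq_mul]
  simp only [map_smul, smul_eq_mul, ← sq]
  exact inv_mul_cancel₀ (sum_sq_ne_zero hβ)

/-- `β` lives in degree `t`. -/
def IsDegForm (t : ℕ) (β : Module.Dual ℝ (Ext n)) : Prop :=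
  ∀ s x, x ∈ ⋀[ℝ]^s (Model n) → s ≠ t → β x = 0

theorem unitMV_mem {t : ℕ} {β : Module.Dual ℝ (Ext n)} (hβ : IsDegForm t β) :
    unitMV β ∈ ⋀[ℝ]^t (Model n) := by
  refine Submodule.smul_mem _ _ (Submodule.sum_mem _ fun S _ => ?_)
  by_cases h : S.card = t
  · exact Submodule.smul_mem _ _ (h ▸ extBasis_mem S)
  · rw [hβ _ _ (extBasis_mem S) h, zero_smul]; exact zero_mem _

theorem fderiv_isDegForm {t : ℕ} {β : Model n → Module.Dual ℝ (Ext n)} {y : Model n}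
    (hβ : DifferentiableAt ℝ β y) (h : ∀ᶠ z in 𝓝 y, IsDegForm t (β z)) (v : Model n) :
    IsDegForm t (fderiv ℝ β y v) := by
  intro s x hx hs
  have h1 := hβ.hasFDerivAt.linear_comp
    (LinearMap.applyₗ x : Module.Dual ℝ (Ext n) →ₗ[ℝ] ℝ)
  have h2 : HasFDerivAt (fun _ : Model n => (0 : ℝ)) _ y :=
    h1.congr_of_eventuallyEq (h.mono fun z hz => (hz s x hx hs).symm)
  exact congrArg (fun K => K v) (h2.unique (hasFDerivAt_const (0 : ℝ) y))

theorem fderiv_mem_deg {k : ℕ} {P : Model n → Ext n} {y : Model n}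
    (hP : DifferentiableAt ℝ P y) (h : ∀ᶠ z in 𝓝 y, P z ∈ ⋀[ℝ]^k (Model n)) (v : Model n) :
    fderiv ℝ P y v ∈ ⋀[ℝ]^k (Model n) := by
  refine mem_deg_iff.2 fun S hS => ?_
  have h1 := hP.hasFDerivAt.linear_comp ((extBasis n).coord S)
  have h2 : HasFDerivAt (fun _ : Model n => (0 : ℝ)) _ y :=
    h1.congr_of_eventuallyEq (h.mono fun z hz => (mem_deg_iff.1 hz S hS).symm)
  exact congrArg (fun K => K v) (h2.unique (hasFDerivAt_const (0 : ℝ) y))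

/-- The flat part `∑ᵢ (-1)^(k-1) (dxⁱ ⌟ P) ∧ ∂ᵢQ` of the connection. -/
def flatCov (P Q : Model n → Ext n) (y : Model n) : Ext n :=
  ∑ i, gradeInv (contr i (P y)) * partialMV Q i y

/-- The correction coefficient `∑ᵢ (∂ᵢβ)((-1)^(k-1) (dxⁱ ⌟ x) ∧ z)`. -/
def corrCoeff (β : Model n → Module.Dual ℝ (Ext n)) (y : Model n) (x z : Ext n) : ℝ :=
  ∑ i, fderiv ℝ β y (stdBasis n i) (gradeInv (contr i x) * z)

/-- The higher connection in a chart in which the forms `w t`, `t ∈ T`, are parallel. -/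
def locCov (T : Finset ℕ) (w : ℕ → Model n → Module.Dual ℝ (Ext n)) (P Q : Model n → Ext n)
    (y : Model n) : Ext n :=
  flatCov P Q y + ∑ t ∈ T, corrCoeff (w t) y (P y) (posPart (Q y)) • unitMV (w t y)

variable {T : Finset ℕ} {w : ℕ → Model n → Module.Dual ℝ (Ext n)} {P P' Q Q' : Model n → Ext n}
  {y : Model n} {k l : ℕ}

theorem contr_mem {x : Ext n} (hx : x ∈ ⋀[ℝ]^(k + 1) (Model n)) (i : Fin n) :
    contr i x ∈ ⋀[ℝ]^k (Model n) := ctr_mem _ hx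

theorem contr_of_mem_zero {x : Ext n} (hx : x ∈ ⋀[ℝ]^0 (Model n)) (i : Fin n) :
    contr i x = 0 := ctr_of_mem_zero _ hx

theorem gradeInv_mem {x : Ext n} (hx : x ∈ ⋀[ℝ]^k (Model n)) :
    gradeInv x ∈ ⋀[ℝ]^k (Model n) := by
  rw [gradeInv_of_mem hx]; exact Submodule.smul_mem _ _ hx

theorem gradeInv_contr_mul_mem {j : ℕ} {x z : Ext n} (hx : x ∈ ⋀[ℝ]^k (Model n))
    (hz : z ∈ ⋀[ℝ]^l (Model n)) (h : j + 1 = k + l) (i : Fin n) :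
    gradeInv (contr i x) * z ∈ ⋀[ℝ]^j (Model n) := by
  cases k with
  | zero => rw [contr_of_mem_zero hx, map_zero, zero_mul]; exact zero_mem _
  | succ k =>
    obtain rfl : j = k + l := by omega
    exact mul_mem_deg (gradeInv_mem (contr_mem hx i)) hz

/-- The derivatives of a form of degree `t` again have degree `t`, and they are evaluated on a
multivector of degree `k + l - 1`. -/
theorem corrCoeff_of_ne {β : Model n → Module.Dual ℝ (Ext n)} {j t : ℕ}
    (hβ : DifferentiableAt ℝ β y) (h : ∀ᶠ z in 𝓝 y, IsDegForm t (β z)) {x z : Ext n}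
    (hx : x ∈ ⋀[ℝ]^k (Model n)) (hz : z ∈ ⋀[ℝ]^l (Model n)) (hj : j + 1 = k + l) (hjt : j ≠ t) :
    corrCoeff β y x z = 0 :=
  Finset.sum_eq_zero fun i _ =>
    fderiv_isDegForm hβ h _ j _ (gradeInv_contr_mul_mem hx hz hj i) hjt

theorem locCov_mem {j : ℕ} (hw : ∀ t ∈ T, DifferentiableAt ℝ (w t) y)
    (hw' : ∀ t ∈ T, ∀ᶠ z in 𝓝 y, IsDegForm t (w t z)) (hQ : DifferentiableAt ℝ Q y)
    (hPk : P y ∈ ⋀[ℝ]^k (Model n)) (hQl : ∀ᶠ z in 𝓝 y, Q z ∈ ⋀[ℝ]^l (Model n))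
    (h : j + 1 = k + l) : locCov T w P Q y ∈ ⋀[ℝ]^j (Model n) := by
  refine add_mem (Submodule.sum_mem _ fun i _ => ?_) (Submodule.sum_mem _ fun t ht => ?_)
  · rw [partialMV_eq hQ]
    exact gradeInv_contr_mul_mem hPk (fderiv_mem_deg hQ hQl _) h i
  · by_cases hj : j = t
    · subst hj
      exact Submodule.smul_mem _ _ (unitMV_mem (hw' j ht).self_of_nhds)
    · rw [corrCoeff_of_ne (hw t ht) (hw' t ht) hPk (posPart_mem hQl.self_of_nhds) h hj, zero_smul]
      exact zero_mem _

theorem contr_add (i : Fin n) (x z : Ext n) : contr i (x + z) = contr i x + contr i z := by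
  simp only [contr_eq, map_add]

theorem contr_smul (i : Fin n) (r : ℝ) (x : Ext n) : contr i (r • x) = r • contr i x := by
  simp only [contr_eq, map_smul]

/-- The hypothesis concerns the single point `y`, because `P` is never differentiated; the
dependence on `P` is tensorial. -/
theorem locCov_linear_left (r : ℝ) {P'' : Model n → Ext n} (h : P'' y = r • P y + P' y) :
    locCov T w P'' Q y = r • locCov T w P Q y + locCov T w P' Q y := by
  simp only [locCov, flatCov, corrCoeff, h, contr_add, contr_smul, map_add, map_smul, add_mul,
    smul_mul_assoc, Finset.sum_add_distrib, smul_add, add_smul, Finset.smul_sum, Finset.sum_smul,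
    smul_smul, smul_eq_mul]
  abel

theorem locCov_add_right (hQ : DifferentiableAt ℝ Q y) (hQ' : DifferentiableAt ℝ Q' y) :
    locCov T w P (fun z => Q z + Q' z) y = locCov T w P Q y + locCov T w P Q' y := by
  simp only [locCov, flatCov, corrCoeff, partialMV_eq hQ, partialMV_eq hQ',
    partialMV_eq (hQ.fun_add hQ'), fderiv_fun_add hQ hQ', posPart_add, mul_add, map_add,
    Finset.sum_add_distrib, add_smul, _root_.add_apply]
  abel

theorem locCov_of_mem_zero (hP : P y ∈ ⋀[ℝ]^0 (Model n)) : locCov T w P Q y = 0 := by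
  simp [locCov, flatCov, corrCoeff, contr_of_mem_zero hP]

theorem fderiv_smul_ext {f : Model n → ℝ} (hf : DifferentiableAt ℝ f y)
    (hQ : DifferentiableAt ℝ Q y) (v : Model n) :
    fderiv ℝ (fun z => f z • Q z) y v = f y • fderiv ℝ Q y v + fderiv ℝ f y v • Q y := by
  rw [fderiv_fun_smul hf hQ]; rfl

theorem schoutenLocal_fun {f : Model n → ℝ} (hf : DifferentiableAt ℝ f y) :
    schoutenLocal P (fun z => algebraMap ℝ (Ext n) (f z)) y =
      ∑ i, fderiv ℝ f y (stdBasis n i) • gradeInv (contr i (P y)) := by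
  have h1 : (fun z => algebraMap ℝ (Ext n) (f z)) = fun z => f z • (1 : Ext n) := by
    funext z; rw [Algebra.algebraMap_eq_smul_one]
  have hd : DifferentiableAt ℝ (fun z => f z • (1 : Ext n)) y :=
    hf.fun_smul (differentiableAt_const _)
  rw [schoutenLocal, h1]
  refine Finset.sum_congr rfl fun i _ => ?_
  rw [partialMV_eq hd, fderiv_smul_ext hf (differentiableAt_const _)]
  simp [contr_eq]

end

/-! ### Leibniz rule, torsion, parallelism and smoothness of the chart connection. -/

section

variable {n : ℕ} {T : Finset ℕ} {w : ℕ → Model n → Module.Dual ℝ (Ext n)}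
  {P P' Q Q' : Model n → Ext n} {y : Model n} {k l : ℕ}

/-- Only the flat part differentiates `Q`, and its extra term is the bracket with `f`; the
correction is linear over functions. -/
theorem locCov_leibniz {f : Model n → ℝ} (hf : DifferentiableAt ℝ f y)
    (hQ : DifferentiableAt ℝ Q y) :
    locCov T w P (fun z => f z • Q z) y =
      schoutenLocal P (fun z => algebraMap ℝ (Ext n) (f z)) y * Q y
        + f y • locCov T w P Q y := by
  rw [schoutenLocal_fun hf]
  simp only [locCov, flatCov, corrCoeff, partialMV_eq hQ, partialMV_eq (hf.fun_smul hQ),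
    fderiv_smul_ext hf hQ, posPart_smul, mul_add, mul_smul_comm, map_smul, smul_add,
    Finset.sum_add_distrib, Finset.smul_sum, Finset.sum_mul, smul_mul_assoc, Finset.sum_smul,
    smul_smul, smul_eq_mul]
  abel

theorem neg_one_pow_eq_zpow (k : ℕ) : (-1 : ℝ) ^ k = (-1 : ℝ) ^ (k : ℤ) := (zpow_natCast _ _).symm

/-- Graded commutation of a contraction past a multivector. -/
theorem sign_smul_gradeInv_contr_mul {x z : Ext n} (hx : x ∈ ⋀[ℝ]^k (Model n))
    (hz : z ∈ ⋀[ℝ]^l (Model n)) (i : Fin n) :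
    (-1 : ℝ) ^ (((k : ℤ) - 1) * ((l : ℤ) - 1)) • (gradeInv (contr i x) * z) = z * contr i x := by
  cases k with
  | zero => simp [contr_of_mem_zero hx]
  | succ k =>
    have hc := contr_mem hx i
    rw [gradeInv_of_mem hc, smul_mul_assoc, mul_comm_deg hc hz, smul_smul, smul_smul,
      neg_one_pow_eq_zpow, neg_one_pow_eq_zpow, ← zpow_add₀ (by norm_num),
      ← zpow_add₀ (by norm_num), Even.neg_one_zpow, one_smul]
    -- As `x` now has degree `k + 1`, the exponents add up to `k(l - 1) + k + kl = 2kl`.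
    refine ⟨(k : ℤ) * l, ?_⟩
    push_cast
    ring

theorem sign_comm (k l : ℕ) : (-1 : ℝ) ^ (((k : ℤ) - 1) * ((l : ℤ) - 1)) =
    (-1 : ℝ) ^ (((l : ℤ) - 1) * ((k : ℤ) - 1)) := by rw [mul_comm]

/-- The torsion sign is exactly the one that moves the contraction of `Q` past `∂ᵢP`, which turns
the reversed term into the second half of the bracket formula. -/
theorem flatCov_torsion (hP : DifferentiableAt ℝ P y)
    (hPk : ∀ᶠ z in 𝓝 y, P z ∈ ⋀[ℝ]^k (Model n)) (hQl : Q y ∈ ⋀[ℝ]^l (Model n)) :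
    flatCov P Q y - (-1 : ℝ) ^ (((k : ℤ) - 1) * ((l : ℤ) - 1)) • flatCov Q P y
      = schoutenLocal P Q y := by
  rw [flatCov, flatCov, schoutenLocal, Finset.sum_sub_distrib, Finset.smul_sum]
  congr 1
  refine Finset.sum_congr rfl fun i _ => ?_
  rw [sign_comm, partialMV_eq hP]
  exact sign_smul_gradeInv_contr_mul hQl (fderiv_mem_deg hP hPk _) i

/-- After reordering, the difference of the two arguments of `∂ᵢβ` is, up to sign, the Leibniz
expansion of `dxⁱ ⌟ (x ∧ z)`, which is zero. -/
theorem corrCoeff_torsion (β : Model n → Module.Dual ℝ (Ext n)) {x z : Ext n}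
    (hx : x ∈ ⋀[ℝ]^k (Model n)) (hz : z ∈ ⋀[ℝ]^l (Model n)) (h : x * z = 0) :
    corrCoeff β y x (posPart z)
      - (-1 : ℝ) ^ (((k : ℤ) - 1) * ((l : ℤ) - 1)) * corrCoeff β y z (posPart x) = 0 := by
  rw [posPart_of_mem hx, posPart_of_mem hz]
  -- If one degree is `0`, both terms vanish separately: contraction kills a scalar, and so does
  -- passing to the part of positive degree.
  rcases Nat.eq_zero_or_pos k with rfl | hk
  · simp [corrCoeff, contr_of_mem_zero hx]
  rcases Nat.eq_zero_or_pos l with rfl | hl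
  · simp [corrCoeff, contr_of_mem_zero hz]
  rw [if_neg hk.ne', if_neg hl.ne', corrCoeff, corrCoeff, Finset.mul_sum,
    ← Finset.sum_sub_distrib]
  refine Finset.sum_eq_zero fun i _ => ?_
  rw [← smul_eq_mul (a := (-1 : ℝ) ^ _), ← map_smul, ← map_sub, sign_comm,
    sign_smul_gradeInv_contr_mul hz hx i]
  suffices h0 : gradeInv (contr i x) * z - x * contr i z = 0 by rw [h0, map_zero]
  have h1 : contr i x * z + gradeInv x * contr i z = 0 := by
    have := ctr_mul ((stdBasis n).coord i) x z
    rw [h, map_zero] at this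
    exact this.symm
  obtain ⟨k, rfl⟩ : ∃ j, k = j + 1 := ⟨k - 1, by omega⟩
  rw [gradeInv_of_mem hx, smul_mul_assoc] at h1
  rw [gradeInv_of_mem (contr_mem hx i), smul_mul_assoc, eq_neg_of_add_eq_zero_left h1, pow_succ]
  rw [smul_neg, smul_smul, mul_neg_one, mul_neg, ← pow_add, Even.neg_one_pow ⟨k, rfl⟩]
  simp

/-- The connection in a chart is torsion free on `X ∧ Y = 0`. -/
theorem locCov_torsion (hP : DifferentiableAt ℝ P y)
    (hPk : ∀ᶠ z in 𝓝 y, P z ∈ ⋀[ℝ]^k (Model n)) (hQl : Q y ∈ ⋀[ℝ]^l (Model n))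
    (h : P y * Q y = 0) :
    locCov T w P Q y - (-1 : ℝ) ^ (((k : ℤ) - 1) * ((l : ℤ) - 1)) • locCov T w Q P y
      = schoutenLocal P Q y := by
  rw [← flatCov_torsion hP hPk hQl, locCov, locCov, smul_add, Finset.smul_sum, add_sub_add_comm,
    ← Finset.sum_sub_distrib]
  refine (add_eq_left).2 (Finset.sum_eq_zero fun t _ => ?_)
  rw [smul_smul, ← sub_smul, corrCoeff_torsion _ hPk.self_of_nhds hQl h, zero_smul]

/-- The connection in a chart is torsion free on vector fields. -/
theorem locCov_torsion_one (hT : 1 ∉ T) (hw : ∀ t ∈ T, DifferentiableAt ℝ (w t) y)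
    (hw' : ∀ t ∈ T, ∀ᶠ z in 𝓝 y, IsDegForm t (w t z)) (hP : DifferentiableAt ℝ P y)
    (hPk : ∀ᶠ z in 𝓝 y, P z ∈ ⋀[ℝ]^1 (Model n)) (hQl : Q y ∈ ⋀[ℝ]^1 (Model n)) :
    locCov T w P Q y - (-1 : ℝ) ^ (((1 : ℕ) - 1 : ℤ) * (((1 : ℕ) : ℤ) - 1)) • locCov T w Q P y
      = schoutenLocal P Q y := by
  rw [← flatCov_torsion hP hPk hQl, locCov, locCov]
  -- For two vectors the coefficients only see forms of degree `1 + 1 - 1 = 1`, and `1 ∉ T`.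
  have h : ∀ x z : Ext n, x ∈ ⋀[ℝ]^1 (Model n) → z ∈ ⋀[ℝ]^1 (Model n) →
      ∑ t ∈ T, corrCoeff (w t) y x (posPart z) • unitMV (w t y) = 0 := by
    intro x z hx hz
    refine Finset.sum_eq_zero fun t ht => ?_
    rw [corrCoeff_of_ne (hw t ht) (hw' t ht) hx (posPart_mem hz) (j := 1) rfl, zero_smul]
    rintro rfl
    exact hT ht
  rw [h _ _ hPk.self_of_nhds hQl, h _ _ hQl hPk.self_of_nhds, add_zero, add_zero]

/-- `z ↦ i_{Q z} (β z)`. -/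
def contrForm (β : Model n → Module.Dual ℝ (Ext n)) (Q : Model n → Ext n) (z : Model n) :
    Module.Dual ℝ (Ext n) :=
  β z ∘ₗ LinearMap.mulLeft ℝ (Q z)

/-- The bilinear map `(β, x) ↦ i_x β`. -/
def contrFormBilin (n : ℕ) : Module.Dual ℝ (Ext n) →ₗ[ℝ] Ext n →ₗ[ℝ] Module.Dual ℝ (Ext n) :=
  LinearMap.mk₂ ℝ (fun β x => β ∘ₗ LinearMap.mulLeft ℝ x)
    (fun _ _ _ => rfl) (fun _ _ _ => rfl)
    (fun β x x' => LinearMap.ext fun z => by simp [add_mul])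
    (fun r β x => LinearMap.ext fun z => by simp)

theorem fderiv_contrForm {β : Model n → Module.Dual ℝ (Ext n)} (hβ : DifferentiableAt ℝ β y)
    (hQ : DifferentiableAt ℝ Q y) (v : Model n) (x : Ext n) :
    DifferentiableAt ℝ (contrForm β Q) y ∧ fderiv ℝ (contrForm β Q) y v x =
      β y (fderiv ℝ Q y v * x) + fderiv ℝ β y v (Q y * x) := by
  have := HasFDerivAt.bilin (contrFormBilin n) hβ.hasFDerivAt hQ.hasFDerivAt
  have h2 : HasFDerivAt (contrForm β Q) _ y := this
  refine ⟨h2.differentiableAt, ?_⟩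
  rw [h2.fderiv]
  rfl

/-- In a chart, `ω(∇_P Q) = ± (d i_Q ω)(P)` for `ω = w t`. -/
theorem apply_locCov {t : ℕ} (ht : t ∈ T) (hw : ∀ t ∈ T, DifferentiableAt ℝ (w t) y)
    (hw' : ∀ t ∈ T, ∀ᶠ z in 𝓝 y, IsDegForm t (w t z)) (hw0 : w t y ≠ 0)
    (hQ : DifferentiableAt ℝ Q y) (hPk : P y ∈ ⋀[ℝ]^k (Model n))
    (hQl : ∀ᶠ z in 𝓝 y, Q z ∈ ⋀[ℝ]^l (Model n)) (hl : 0 < l) (h : t + 1 = k + l) :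
    w t y (locCov T w P Q y) = (-1 : ℝ) ^ (((k : ℤ) - 1) * ((t : ℤ) - 1)) *
      -((-1 : ℝ) ^ k * dLocal (contrForm (w t) Q) y (P y)) := by
  -- Since `t = k + l - 1`, the exponents `(k-1)(l-1)` and `(k-1)(t-1) + k + 1` have the same
  -- parity; the extra `k + 1` is the factor `-(-1)^k` of the claim.
  have hsign : ∀ z : Ext n, z ∈ ⋀[ℝ]^l (Model n) → ∀ i, gradeInv (contr i (P y)) * z =
      (-1 : ℝ) ^ (((k : ℤ) - 1) * ((t : ℤ) - 1) + k + 1) • (z * contr i (P y)) := by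
    intro z hz i
    rw [← sign_smul_gradeInv_contr_mul hPk hz i, smul_smul, ← zpow_add₀ (by norm_num),
      Even.neg_one_zpow, one_smul]
    have ht' : (t : ℤ) = k + l - 1 := by omega
    rw [ht']
    have e : ((k : ℤ) - 1) * ((k : ℤ) + l - 1 - 1) + k + 1 + (k - 1) * (l - 1) =
        (k * (k - 1)) + 2 * ((k - 1) * (l - 1) + 1) := by ring
    rw [e]
    exact (Int.even_mul_pred_self k).add (even_two_mul _)
  -- The unit multivectors are dual to the forms for degree reasons, so `w t` detects only its own
  -- correction.
  have hunit : ∀ s ∈ T, w t y (unitMV (w s y)) = if s = t then 1 else 0 := by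
    intro s hs
    split_ifs with h
    · subst h; exact apply_unitMV hw0
    · exact (hw' t ht).self_of_nhds s _ (unitMV_mem (hw' s hs).self_of_nhds) h
  rw [locCov, map_add, map_sum, Finset.sum_eq_single t]
  rotate_left
  · intro s hs hst
    rw [map_smul, hunit s hs, if_neg hst, smul_zero]
  · exact fun h => absurd ht h
  rw [map_smul, hunit t ht, if_pos rfl, smul_eq_mul, mul_one, posPart_of_mem hQl.self_of_nhds,
    if_neg hl.ne', flatCov, corrCoeff, map_sum, ← Finset.sum_add_distrib, dLocal, Finset.mul_sum,
    ← Finset.sum_neg_distrib, Finset.mul_sum]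
  -- Termwise this is the product rule for `i_Q ω`: the flat part supplies the derivative of `Q`,
  -- the correction that of `ω`.
  refine Finset.sum_congr rfl fun i _ => ?_
  rw [(fderiv_contrForm (hw t ht) hQ _ _).2, partialMV_eq hQ,
    hsign _ (fderiv_mem_deg hQ hQl _), hsign _ hQl.self_of_nhds, map_smul, map_smul, smul_eq_mul,
    smul_eq_mul, zpow_add₀ (by norm_num), zpow_add₀ (by norm_num), zpow_one, ← neg_one_pow_eq_zpow]
  ring

/-! ### Smoothness -/

theorem contDiffAt_fderiv_apply {E : Type*} [NormedAddCommGroup E] [NormedSpace ℝ E]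
    {f : Model n → E} (hf : ContDiffAt ℝ ∞ f y) (v : Model n) :
    ContDiffAt ℝ ∞ (fun z => fderiv ℝ f z v) y :=
  (hf.fderiv_right (m := ∞) (by norm_cast)).clm_apply contDiffAt_const

/-- The only denominator is the sum of squares in `unitMV`; it is nonzero because the form does not
vanish at `y`. -/
theorem contDiffAt_locCov (hw : ∀ t ∈ T, ContDiffAt ℝ ∞ (w t) y) (hw0 : ∀ t ∈ T, w t y ≠ 0)
    (hP : ContDiffAt ℝ ∞ P y) (hQ : ContDiffAt ℝ ∞ Q y) :
    ContDiffAt ℝ ∞ (locCov T w P Q) y := by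
  have hgc : ∀ i, ContDiffAt ℝ ∞ (fun z => gradeInv (contr i (P z))) y := fun i =>
    hP.linear_comp ((gradeInv (n := n)).toLinearMap ∘ₗ ctr ((stdBasis n).coord i))
  have hpart : ∀ i, ContDiffAt ℝ ∞ (fun z => partialMV Q i z) y := fun i => by
    refine (contDiffAt_fderiv_apply hQ (stdBasis n i)).congr_of_eventuallyEq ?_
    -- The order is lowered to `1` because regularity of finite order at `y` spreads to a
    -- neighbourhood, which `ContDiffAt` of order `∞` need not do.
    filter_upwards [(hQ.of_le (m := 1) (by norm_cast)).eventually (by simp)] with z hz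
    exact partialMV_eq (hz.differentiableAt (by simp)) i
  have hpos : ContDiffAt ℝ ∞ (fun z => posPart (Q z)) y :=
    hQ.linear_comp (LinearMap.id - degProj 0)
  refine ContDiffAt.add (ContDiffAt.sum fun i _ => contDiffAt_ext_mul (hgc i) (hpart i))
    (ContDiffAt.sum fun t ht => ContDiffAt.smul (f := fun z => corrCoeff (w t) z (P z)
      (posPart (Q z))) (g := fun z => unitMV (w t z)) ?_ ?_)
  · refine ContDiffAt.sum fun i _ => ?_
    exact ContDiffAt.bilin (LinearMap.id : Module.Dual ℝ (Ext n) →ₗ[ℝ] Ext n →ₗ[ℝ] ℝ)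
      (contDiffAt_fderiv_apply (hw t ht) _) (contDiffAt_ext_mul (hgc i) hpos)
  · have hS := contDiffAt_dual_iff.1 (hw t ht)
    refine ContDiffAt.smul (f := fun z => (∑ S, w t z (extBasis n S) ^ 2)⁻¹)
      (g := fun z => ∑ S, w t z (extBasis n S) • extBasis n S) ?_ ?_
    · exact (ContDiffAt.sum fun S _ => (hS S).pow 2).inv (sum_sq_ne_zero (hw0 t ht))
    · exact ContDiffAt.sum fun S _ => (hS S).smul contDiffAt_const

end

section

/-! ## Chart changes -/

variable {n : ℕ} {M : Type*} [TopologicalSpace M] [ChartedSpace (Model n) M]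
  [IsManifold (𝓡 n) ∞ M]

/-- The coordinate change from the chart around `b` to the chart around `a`. -/
def coordChange (n : ℕ) {M : Type*} [TopologicalSpace M] [ChartedSpace (Model n) M] (a b : M) :
    Model n → Model n :=
  extChartAt (𝓡 n) a ∘ (extChartAt (𝓡 n) b).symm

omit [IsManifold (𝓡 n) ∞ M] in
theorem coordChange_apply {a b q : M} (hb : q ∈ (extChartAt (𝓡 n) b).source) :
    coordChange n a b (extChartAt (𝓡 n) b q) = extChartAt (𝓡 n) a q := by
  rw [coordChange, Function.comp_apply, (extChartAt (𝓡 n) b).left_inv hb]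

theorem contDiffAt_coordChange {a b q : M} (ha : q ∈ (extChartAt (𝓡 n) a).source)
    (hb : q ∈ (extChartAt (𝓡 n) b).source) :
    ContDiffAt ℝ ∞ (coordChange n a b) (extChartAt (𝓡 n) b q) := by
  have h := contDiffWithinAt_ext_coord_change (I := 𝓡 n) (n := ∞) a b
    (y := extChartAt (𝓡 n) b q) (by
      rw [PartialEquiv.trans_source, PartialEquiv.symm_source]
      refine ⟨(extChartAt (𝓡 n) b).map_source hb, ?_⟩
      rwa [Set.mem_preimage, (extChartAt (𝓡 n) b).left_inv hb])
  rwa [ModelWithCorners.range_eq_univ, contDiffWithinAt_univ] at h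

omit [IsManifold (𝓡 n) ∞ M] in
theorem eventually_mem_charts {a b q : M} (ha : q ∈ (extChartAt (𝓡 n) a).source)
    (hb : q ∈ (extChartAt (𝓡 n) b).source) :
    ∀ᶠ z in 𝓝 (extChartAt (𝓡 n) b q), z ∈ (extChartAt (𝓡 n) b).target ∧
      (extChartAt (𝓡 n) b).symm z ∈ (extChartAt (𝓡 n) a).source := by
  refine Filter.Eventually.and ((isOpen_extChartAt_target b).mem_nhds
    ((extChartAt (𝓡 n) b).map_source hb)) ?_
  have hc : ContinuousAt (extChartAt (𝓡 n) b).symm (extChartAt (𝓡 n) b q) :=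
    continuousAt_extChartAt_symm' hb
  refine hc.preimage_mem_nhds ?_
  rw [(extChartAt (𝓡 n) b).left_inv hb]
  exact (isOpen_extChartAt_source a).mem_nhds ha

theorem chartDiff_coordChange {a b q : M} (ha : q ∈ (extChartAt (𝓡 n) a).source)
    (hb : q ∈ (extChartAt (𝓡 n) b).source) :
    chartDiff a q = (fderiv ℝ (coordChange n a b) (extChartAt (𝓡 n) b q)).comp
      (chartDiff b q) := by
  have h1 : MDifferentiableAt (𝓡 n) 𝓘(ℝ, Model n) (extChartAt (𝓡 n) b) q :=
    mdifferentiableAt_extChartAt (by rwa [extChartAt_source] at hb)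
  have h2 : MDifferentiableAt 𝓘(ℝ, Model n) 𝓘(ℝ, Model n) (coordChange n a b)
      (extChartAt (𝓡 n) b q) :=
    ((contDiffAt_coordChange ha hb).differentiableAt (by simp)).mdifferentiableAt
  have h3 := mfderiv_comp q h2 h1
  rw [mfderiv_eq_fderiv] at h3
  refine Eq.trans ?_ h3
  refine Filter.EventuallyEq.mfderiv_eq ?_
  filter_upwards [(isOpen_extChartAt_source (I := 𝓡 n) b).mem_nhds hb] with z hz
  exact (coordChange_apply hz).symm

theorem chartExt_coordChange {a b q : M} (ha : q ∈ (extChartAt (𝓡 n) a).source)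
    (hb : q ∈ (extChartAt (𝓡 n) b).source) (x : ExtFibre n q) :
    chartExt a q x = ExteriorAlgebra.map
      (fderiv ℝ (coordChange n a b) (extChartAt (𝓡 n) b q)).toLinearMap (chartExt b q x) := by
  rw [chartExt, chartDiff_coordChange ha hb, chartExt, ← AlgHom.comp_apply,
    ExteriorAlgebra.map_comp_map]
  rfl

theorem chartExt_chartExtInv {a q : M} (ha : q ∈ (extChartAt (𝓡 n) a).source) (x : Ext n) :
    chartExt a q (chartExtInv a q x) = x := by
  have h : (chartDiff (n := n) a q).IsInvertible := isInvertible_mfderiv_extChartAt ha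
  have h2 : (chartDiff (n := n) a q).toLinearMap ∘ₗ (chartDiff a q).inverse.toLinearMap =
      LinearMap.id := by
    ext1 v
    exact h.self_apply_inverse v
  rw [chartExt, chartExtInv, ← AlgHom.comp_apply, ExteriorAlgebra.map_comp_map, h2,
    ExteriorAlgebra.map_id]
  rfl

theorem chartExtInv_chartExt {a q : M} (ha : q ∈ (extChartAt (𝓡 n) a).source)
    (x : ExtFibre n q) : chartExtInv a q (chartExt a q x) = x := by
  have h : (chartDiff (n := n) a q).IsInvertible := isInvertible_mfderiv_extChartAt ha
  have h2 : (chartDiff (n := n) a q).inverse.toLinearMap ∘ₗ (chartDiff a q).toLinearMap =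
      LinearMap.id := by
    ext1 v
    exact h.inverse_apply_self v
  rw [chartExt, chartExtInv, ← AlgHom.comp_apply, ExteriorAlgebra.map_comp_map, h2,
    ExteriorAlgebra.map_id]
  rfl

theorem chartExt_injective {a q : M} (ha : q ∈ (extChartAt (𝓡 n) a).source) :
    Function.Injective (chartExt (n := n) a q) :=
  Function.LeftInverse.injective (chartExtInv_chartExt ha)

omit [IsManifold (𝓡 n) ∞ M] in
theorem coordMVF_apply {a q : M} (ha : q ∈ (extChartAt (𝓡 n) a).source) (X : RoughMVF n M) :
    coordMVF X a (extChartAt (𝓡 n) a q) = chartExt a q (X q) := by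
  rw [coordMVF, (extChartAt (𝓡 n) a).left_inv ha]

theorem coordForm_apply {a q : M} (ha : q ∈ (extChartAt (𝓡 n) a).source) (α : RoughForm n M)
    (x : ExtFibre n q) :
    coordForm α a (extChartAt (𝓡 n) a q) (chartExt a q x) = α q x := by
  rw [coordForm, (extChartAt (𝓡 n) a).left_inv ha, LinearMap.comp_apply,
    AlgHom.toLinearMap_apply, chartExtInv_chartExt ha]

theorem pushMV_coordMVF {a b q : M} (ha : q ∈ (extChartAt (𝓡 n) a).source)
    (hb : q ∈ (extChartAt (𝓡 n) b).source) (X : RoughMVF n M) :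
    PushMV (coordChange n a b) (extChartAt (𝓡 n) b q) (coordMVF X b) (coordMVF X a) := by
  filter_upwards [eventually_mem_charts ha hb] with z ⟨hz, hz'⟩
  obtain ⟨r, hr, rfl⟩ : ∃ r ∈ (extChartAt (𝓡 n) b).source, extChartAt (𝓡 n) b r = z :=
    ⟨_, (extChartAt (𝓡 n) b).map_target hz, (extChartAt (𝓡 n) b).right_inv hz⟩
  rw [(extChartAt (𝓡 n) b).left_inv hr] at hz'
  rw [coordChange_apply hr, coordMVF_apply hz', coordMVF_apply hr, chartExt_coordChange hz' hr]

theorem pullForm_coordForm {a b q : M} (ha : q ∈ (extChartAt (𝓡 n) a).source)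
    (hb : q ∈ (extChartAt (𝓡 n) b).source) (α : RoughForm n M) :
    PullForm (coordChange n a b) (extChartAt (𝓡 n) b q) (coordForm α b) (coordForm α a) := by
  filter_upwards [eventually_mem_charts ha hb] with z ⟨hz, hz'⟩
  obtain ⟨r, hr, rfl⟩ : ∃ r ∈ (extChartAt (𝓡 n) b).source, extChartAt (𝓡 n) b r = z :=
    ⟨_, (extChartAt (𝓡 n) b).map_target hz, (extChartAt (𝓡 n) b).right_inv hz⟩
  rw [(extChartAt (𝓡 n) b).left_inv hr] at hz'
  refine LinearMap.ext fun x => ?_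
  rw [LinearMap.comp_apply, AlgHom.toLinearMap_apply, coordChange_apply hr,
    ← chartExt_chartExtInv hr x, ← chartExt_coordChange hz' hr, coordForm_apply hr,
    coordForm_apply hz']

/-! ### Smoothness in charts -/

omit [IsManifold (𝓡 n) ∞ M] in
theorem IsSmoothMVF.contDiffAt {X : RoughMVF n M} (hX : IsSmoothMVF X) {a q : M}
    (ha : q ∈ (extChartAt (𝓡 n) a).source) :
    ContDiffAt ℝ ∞ (coordMVF X a) (extChartAt (𝓡 n) a q) :=
  contDiffAt_ext_iff.2 fun S => (hX a S).contDiffAt ((isOpen_extChartAt_target a).mem_nhds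
    ((extChartAt (𝓡 n) a).map_source ha))

theorem contDiffAt_coordMVF_congr {X : RoughMVF n M} {a b q : M}
    (ha : q ∈ (extChartAt (𝓡 n) a).source) (hb : q ∈ (extChartAt (𝓡 n) b).source)
    (h : ContDiffAt ℝ ∞ (coordMVF X a) (extChartAt (𝓡 n) a q)) :
    ContDiffAt ℝ ∞ (coordMVF X b) (extChartAt (𝓡 n) b q) := by
  have hg := contDiffAt_coordChange hb ha
  have hg' := contDiffAt_coordChange ha hb
  have hy := coordChange_apply (a := b) ha
  have hy' := coordChange_apply (a := a) hb
  have h1 : ContDiffAt ℝ ∞ (fun z => ExteriorAlgebra.map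
      (fderiv ℝ (coordChange n b a) z).toLinearMap (coordMVF X a z)) (extChartAt (𝓡 n) a q) :=
    contDiffAt_extMap (hg.fderiv_right (m := ∞) (by norm_cast)) h
  rw [← hy'] at h1
  refine (h1.comp _ hg').congr_of_eventuallyEq ?_
  have hpush := pushMV_coordMVF hb ha X
  have hcont : Filter.Tendsto (coordChange n a b) (𝓝 (extChartAt (𝓡 n) b q))
      (𝓝 (extChartAt (𝓡 n) a q)) := by
    have := hg'.continuousAt.tendsto
    rwa [hy'] at this
  filter_upwards [hcont.eventually hpush, eventually_mem_charts ha hb] with z hz ⟨hz1, hz2⟩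
  rw [Function.comp_apply, ← hz]
  congr 1
  rw [coordChange, coordChange, Function.comp_apply, Function.comp_apply,
    (extChartAt (𝓡 n) a).left_inv hz2, (extChartAt (𝓡 n) b).right_inv hz1]

/-- Coordinate changes transport smoothness at a point, so one chart per point suffices; the chart
may be chosen to suit the section. -/
theorem isSmoothMVF_of_contDiffAt {X : RoughMVF n M}
    (h : ∀ q : M, ∃ a : M, q ∈ (extChartAt (𝓡 n) a).source ∧
      ContDiffAt ℝ ∞ (coordMVF X a) (extChartAt (𝓡 n) a q)) : IsSmoothMVF X := by
  intro b S y hy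
  obtain ⟨q, hq, rfl⟩ : ∃ q ∈ (extChartAt (𝓡 n) b).source, extChartAt (𝓡 n) b q = y :=
    ⟨_, (extChartAt (𝓡 n) b).map_target hy, (extChartAt (𝓡 n) b).right_inv hy⟩
  obtain ⟨a, ha, hX⟩ := h q
  exact (contDiffAt_ext_iff.1 (contDiffAt_coordMVF_congr ha hq hX) S).contDiffWithinAt

/-- A form is smooth if it is smooth in all charts. -/
def IsSmoothForm (α : RoughForm n M) : Prop :=
  ∀ a q : M, q ∈ (extChartAt (𝓡 n) a).source →
    ContDiffAt ℝ ∞ (coordForm α a) (extChartAt (𝓡 n) a q)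

/-! ### The bracket and the exterior derivative in arbitrary charts -/

/-- The bracket at `p` is defined in the chart around `p` itself, whereas gluing at `p` involves the
charts around other points; naturality identifies the results. -/
theorem chartExt_schouten {X Y : RoughMVF n M} (hX : IsSmoothMVF X) (hY : IsSmoothMVF Y)
    {a p : M} (ha : p ∈ (extChartAt (𝓡 n) a).source) :
    chartExt a p (schouten X Y p) =
      schoutenLocal (coordMVF X a) (coordMVF Y a) (extChartAt (𝓡 n) a p) := by
  have hp := mem_extChartAt_source (I := 𝓡 n) p
  have e := coordChange_apply (a := a) hp
  rw [chartExt_coordChange ha hp, schouten, chartExt_chartExtInv hp,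
    ← schoutenLocal_push (contDiffAt_coordChange ha hp) (pushMV_coordMVF ha hp X)
      ((hX.contDiffAt hp).differentiableAt (by simp))
      (by rw [e]; exact (hX.contDiffAt ha).differentiableAt (by simp))
      (pushMV_coordMVF ha hp Y)
      ((hY.contDiffAt hp).differentiableAt (by simp))
      (by rw [e]; exact (hY.contDiffAt ha).differentiableAt (by simp)), e]

theorem extDerivForm_apply {α : RoughForm n M} (hα : IsSmoothForm α) {a p : M}
    (ha : p ∈ (extChartAt (𝓡 n) a).source) (x : ExtFibre n p) :
    extDerivForm α p x = dLocal (coordForm α a) (extChartAt (𝓡 n) a p) (chartExt a p x) := by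
  have hp := mem_extChartAt_source (I := 𝓡 n) p
  have e := coordChange_apply (a := a) hp
  have hd := (hα p p hp).differentiableAt (by simp)
  rw [extDerivForm, LinearMap.comp_apply, AlgHom.toLinearMap_apply, extDerivLocal_apply hd,
    dLocal_pull (contDiffAt_coordChange ha hp) (pullForm_coordForm ha hp α) hd
      (by rw [e]; exact (hα a p ha).differentiableAt (by simp)), e,
    ← chartExt_coordChange ha hp]

/-- The identity is local because the chart differential is only inverted on the chart domain. -/
theorem coordForm_interior {a q : M} (ha : q ∈ (extChartAt (𝓡 n) a).source) (X : RoughMVF n M)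
    (α : RoughForm n M) :
    coordForm (interior X α) a =ᶠ[𝓝 (extChartAt (𝓡 n) a q)]
      contrForm (coordForm α a) (coordMVF X a) := by
  filter_upwards [eventually_mem_charts ha ha] with z ⟨_, hz⟩
  refine LinearMap.ext fun x => ?_
  simp only [coordForm, interior, contrForm, LinearMap.comp_apply, AlgHom.toLinearMap_apply,
    LinearMap.mulLeft_apply, map_mul, coordMVF]
  rw [chartExtInv_chartExt hz]

theorem IsSmoothForm.interior {α : RoughForm n M} (hα : IsSmoothForm α) {X : RoughMVF n M}
    (hX : IsSmoothMVF X) : IsSmoothForm (interior X α) := by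
  intro a q ha
  refine ContDiffAt.congr_of_eventuallyEq ?_ (coordForm_interior ha X α)
  exact ContDiffAt.bilin (contrFormBilin n) (hα a q ha) (hX.contDiffAt ha)

end

section

/-! ## Cutting off and gluing local multivector fields -/

variable {n : ℕ} {M : Type*} [TopologicalSpace M] [ChartedSpace (Model n) M]
  [IsManifold (𝓡 n) ∞ M]

theorem contDiffAt_chart_of_contMDiff {f : M → ℝ} (hf : ContMDiff (𝓡 n) 𝓘(ℝ, ℝ) ∞ f) {a q : M}
    (ha : q ∈ (extChartAt (𝓡 n) a).source) :
    ContDiffAt ℝ ∞ (fun z => f ((extChartAt (𝓡 n) a).symm z)) (extChartAt (𝓡 n) a q) :=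
  (hf.comp_contMDiffOn (contMDiffOn_extChartAt_symm a)).contDiffOn.contDiffAt
    ((isOpen_extChartAt_target a).mem_nhds ((extChartAt (𝓡 n) a).map_source ha))

/-- On the support of `f` the chart around `a` is available; off the support the section vanishes
near the point. -/
theorem isSmoothMVF_cutoff {f : M → ℝ} (hf : ContMDiff (𝓡 n) 𝓘(ℝ, ℝ) ∞ f) {a : M}
    (hsupp : tsupport f ⊆ (extChartAt (𝓡 n) a).source) {F : Model n → Ext n}
    (hF : ∀ q ∈ (extChartAt (𝓡 n) a).source, ContDiffAt ℝ ∞ F (extChartAt (𝓡 n) a q)) :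
    IsSmoothMVF (n := n) fun p => f p • chartExtInv a p (F (extChartAt (𝓡 n) a p)) := by
  refine isSmoothMVF_of_contDiffAt fun q => ?_
  by_cases hq : q ∈ tsupport f
  · have ha := hsupp hq
    refine ⟨a, ha, ContDiffAt.congr_of_eventuallyEq (f := fun z =>
      f ((extChartAt (𝓡 n) a).symm z) • F z) ?_ ?_⟩
    · exact (contDiffAt_chart_of_contMDiff hf ha).smul (hF q ha)
    · filter_upwards [eventually_mem_charts ha ha] with z ⟨hz, hz'⟩
      rw [coordMVF, map_smul, chartExt_chartExtInv hz', (extChartAt (𝓡 n) a).right_inv hz]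
  · have hq' := mem_extChartAt_source (I := 𝓡 n) q
    refine ⟨q, hq', ContDiffAt.congr_of_eventuallyEq (f := fun _ => (0 : Ext n))
      contDiffAt_const ?_⟩
    have hc : ContinuousAt (extChartAt (𝓡 n) q).symm (extChartAt (𝓡 n) q q) :=
      continuousAt_extChartAt_symm' hq'
    have hmem : (tsupport f)ᶜ ∈ 𝓝 ((extChartAt (𝓡 n) q).symm (extChartAt (𝓡 n) q q)) := by
      rw [(extChartAt (𝓡 n) q).left_inv hq']
      exact (isClosed_tsupport f).isOpen_compl.mem_nhds hq
    filter_upwards [hc.preimage_mem_nhds hmem] with z hz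
    rw [coordMVF, image_eq_zero_of_notMem_tsupport hz, zero_smul, map_zero]

/-- The value at `p` of the section glued from the chart values `c a`. -/
def glueAt (ρ : SmoothPartitionOfUnity M (𝓡 n) M Set.univ) (p : M) :
    (M → Ext n) →ₗ[ℝ] ExtFibre n p :=
  ∑ a ∈ ρ.finsupport p, ρ a p • (chartExtInv a p).toLinearMap ∘ₗ LinearMap.proj a

variable {ρ : SmoothPartitionOfUnity M (𝓡 n) M Set.univ}

omit [IsManifold (𝓡 n) ∞ M] in
theorem glueAt_apply (p : M) (c : M → Ext n) :
    glueAt ρ p c = ∑ a ∈ ρ.finsupport p, ρ a p • chartExtInv a p (c a) := by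
  simp [glueAt]

omit [IsManifold (𝓡 n) ∞ M] in
theorem mem_source_of_mem_finsupport
    (hρ : ρ.IsSubordinate fun a => (chartAt (Model n) a).source) {p a : M}
    (ha : a ∈ ρ.finsupport p) : p ∈ (extChartAt (𝓡 n) a).source := by
  rw [extChartAt_source]
  exact hρ a (subset_tsupport _ ((ρ.mem_finsupport p).1 ha))

omit [IsManifold (𝓡 n) ∞ M] in
theorem glueAt_congr (hρ : ρ.IsSubordinate fun a => (chartAt (Model n) a).source) {p : M}
    {c c' : M → Ext n} (h : ∀ a, p ∈ (extChartAt (𝓡 n) a).source → c a = c' a) :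
    glueAt ρ p c = glueAt ρ p c' := by
  rw [glueAt_apply, glueAt_apply]
  exact Finset.sum_congr rfl fun a ha => by rw [h a (mem_source_of_mem_finsupport hρ ha)]

/-- The weights sum to `1`, so a value on which all charts agree is reproduced. This carries the
chart identities for torsion and Leibniz rule over to the glued connection. -/
theorem glueAt_eq (hρ : ρ.IsSubordinate fun a => (chartAt (Model n) a).source) {p : M}
    {c : M → Ext n} {v : ExtFibre n p}
    (h : ∀ a, p ∈ (extChartAt (𝓡 n) a).source → c a = chartExt a p v) : glueAt ρ p c = v := by
  rw [glueAt_congr hρ h, glueAt_apply]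
  have : ∀ a ∈ ρ.finsupport p, ρ a p • chartExtInv a p (chartExt a p v) = ρ a p • v :=
    fun a ha => by rw [chartExtInv_chartExt (mem_source_of_mem_finsupport hρ ha)]
  rw [Finset.sum_congr rfl this, ← Finset.sum_smul, ρ.sum_finsupport p (Set.mem_univ p), one_smul]

theorem apply_glueAt (hρ : ρ.IsSubordinate fun a => (chartAt (Model n) a).source) {p : M}
    {c : M → Ext n} {α : RoughForm n M} {r : ℝ}
    (h : ∀ a, p ∈ (extChartAt (𝓡 n) a).source →
      coordForm α a (extChartAt (𝓡 n) a p) (c a) = r) : α p (glueAt ρ p c) = r := by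
  rw [glueAt_apply, map_sum]
  have : ∀ a ∈ ρ.finsupport p, α p (ρ a p • chartExtInv a p (c a)) = ρ a p * r := by
    intro a ha
    have ha' := mem_source_of_mem_finsupport hρ ha
    rw [map_smul, smul_eq_mul, ← h a ha', ← coordForm_apply ha', chartExt_chartExtInv ha']
  rw [Finset.sum_congr rfl this, ← Finset.sum_mul, ρ.sum_finsupport p (Set.mem_univ p), one_mul]

omit [IsManifold (𝓡 n) ∞ M] in
theorem glueAt_mem {p : M} {c : M → Ext n} {j : ℕ}
    (h : ∀ a ∈ ρ.finsupport p, c a ∈ ⋀[ℝ]^j (Model n)) :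
    glueAt ρ p c ∈ ⋀[ℝ]^j (TangentSpace (𝓡 n) p) := by
  rw [glueAt_apply]
  exact Submodule.sum_mem _ fun a ha => Submodule.smul_mem _ _ (map_mem_deg _ (h a ha))

theorem isSmoothMVF_glueAt (hρ : ρ.IsSubordinate fun a => (chartAt (Model n) a).source)
    {F : M → Model n → Ext n}
    (hF : ∀ a, ∀ q ∈ (extChartAt (𝓡 n) a).source, ContDiffAt ℝ ∞ (F a) (extChartAt (𝓡 n) a q)) :
    IsSmoothMVF (n := n) fun p => glueAt ρ p fun a => F a (extChartAt (𝓡 n) a p) := by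
  refine isSmoothMVF_of_contDiffAt fun q => ?_
  have hq := mem_extChartAt_source (I := 𝓡 n) q
  refine ⟨q, hq, ?_⟩
  have hcut : ∀ a, IsSmoothMVF (n := n) fun p =>
      ρ a p • chartExtInv a p (F a (extChartAt (𝓡 n) a p)) := fun a =>
    isSmoothMVF_cutoff (ρ a).contMDiff (by rw [extChartAt_source]; exact hρ a) (hF a)
  -- The index set of the gluing sum varies with the point; near `q` it stays inside the fixed
  -- finite set `ρ.fintsupport q`, and the additional summands are zero.
  have hsum := ContDiffAt.sum (s := ρ.fintsupport q) fun a _ => (hcut a).contDiffAt hq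
  refine hsum.congr_of_eventuallyEq ?_
  have hc : ContinuousAt (extChartAt (𝓡 n) q).symm (extChartAt (𝓡 n) q q) :=
    continuousAt_extChartAt_symm' hq
  have hev := ρ.eventually_finsupport_subset q
  rw [← (extChartAt (𝓡 n) q).left_inv hq] at hev
  filter_upwards [hc.eventually hev] with z hz
  rw [(extChartAt (𝓡 n) q).left_inv hq] at hz
  simp only [coordMVF]
  rw [← map_sum, glueAt_apply]
  congr 1
  refine Finset.sum_subset hz fun a _ ha => ?_
  rw [ρ.mem_finsupport, Function.notMem_support] at ha
  rw [ha, zero_smul]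

/-! ### The components of an associative form -/

omit [IsManifold (𝓡 n) ∞ M] in
theorem component_apply_of_mem (η : AssocForm n M) (t : ℕ) {s : ℕ} {p : M} {x : ExtFibre n p}
    (hx : x ∈ ⋀[ℝ]^s (TangentSpace (𝓡 n) p)) :
    η.component t p x = if s = t then η.form p x 1 else 0 := by
  rw [AssocForm.component, LinearMap.comp_apply, LinearMap.flip_apply]
  split_ifs with h
  · subst h
    have : GradedAlgebra.proj (fun i : ℕ => ⋀[ℝ]^i (TangentSpace (𝓡 n) p)) s x = x :=
      DirectSum.decompose_of_mem_same (fun i : ℕ => ⋀[ℝ]^i (TangentSpace (𝓡 n) p)) hx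
    rw [this]
  · have : GradedAlgebra.proj (fun i : ℕ => ⋀[ℝ]^i (TangentSpace (𝓡 n) p)) t x = 0 :=
      DirectSum.decompose_of_mem_ne (fun i : ℕ => ⋀[ℝ]^i (TangentSpace (𝓡 n) p)) hx h
    rw [this, map_zero, LinearMap.zero_apply]

omit [IsManifold (𝓡 n) ∞ M] in
theorem isDegForm_component (η : AssocForm n M) (t : ℕ) (a : M) (z : Model n) :
    IsDegForm t (coordForm (η.component t) a z) := by
  intro s x hx hs
  rw [coordForm, LinearMap.comp_apply]
  exact (component_apply_of_mem η t (map_mem_deg _ hx)).trans (if_neg hs)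

theorem contDiffAt_coordForm_congr {α : RoughForm n M} {a b q : M}
    (ha : q ∈ (extChartAt (𝓡 n) a).source) (hb : q ∈ (extChartAt (𝓡 n) b).source)
    (h : ContDiffAt ℝ ∞ (coordForm α a) (extChartAt (𝓡 n) a q)) :
    ContDiffAt ℝ ∞ (coordForm α b) (extChartAt (𝓡 n) b q) := by
  have hg := contDiffAt_coordChange ha hb
  refine contDiffAt_dual_iff.2 fun S => ?_
  have h1 : ContDiffAt ℝ ∞ (fun z => ExteriorAlgebra.map
      (fderiv ℝ (coordChange n a b) z).toLinearMap (extBasis n S)) (extChartAt (𝓡 n) b q) :=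
    contDiffAt_extMap (hg.fderiv_right (m := ∞) (by norm_cast)) contDiffAt_const
  rw [← coordChange_apply (a := a) hb] at h
  have h2 := ContDiffAt.bilin (LinearMap.id : Module.Dual ℝ (Ext n) →ₗ[ℝ] Ext n →ₗ[ℝ] ℝ)
    (h.comp _ hg) h1
  refine h2.congr_of_eventuallyEq ?_
  filter_upwards [pullForm_coordForm ha hb α] with z hz
  rw [hz]
  rfl

/-- Smoothness of `η` is tested on global multivector fields. A bump function equal to `1` near `q`
extends the coordinate field of a basis multivector to such a field without changing it near `q`. -/
theorem isSmoothForm_component [T2Space M] (η : AssocForm n M) (t : ℕ) :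
    IsSmoothForm (η.component t) := by
  intro a q ha
  have hq := mem_extChartAt_source (I := 𝓡 n) q
  refine contDiffAt_coordForm_congr hq ha (contDiffAt_dual_iff.2 fun S => ?_)
  by_cases hS : S.card = t
  swap
  · refine contDiffAt_const.congr_of_eventuallyEq (f := fun _ => (0 : ℝ))
      (Filter.Eventually.of_forall fun z => ?_)
    exact isDegForm_component η t q z _ _ (extBasis_mem S) hS
  obtain ⟨f, -⟩ := (SmoothBumpFunction.nhds_basis_tsupport (I := 𝓡 n) q).ex_mem
  let X : MVF n M := ⟨fun p => f p • chartExtInv q p (extBasis n S),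
    isSmoothMVF_cutoff (F := fun _ => extBasis n S) f.contMDiff f.tsupport_subset_extChartAt_source
      fun _ _ => contDiffAt_const⟩
  have hX : X.HasDegree S.card := fun p =>
    Submodule.smul_mem _ _ (map_mem_deg _ (extBasis_mem S))
  have h1 : (1 : MVF n M).HasDegree 0 := fun p => SetLike.one_mem_graded _
  have h := contDiffAt_chart_of_contMDiff (η.smooth hX h1) hq
  refine h.congr_of_eventuallyEq ?_
  have hc : Filter.Tendsto (extChartAt (𝓡 n) q).symm (𝓝 (extChartAt (𝓡 n) q q)) (𝓝 q) := by
    have := (continuousAt_extChartAt_symm' (I := 𝓡 n) hq).tendsto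
    rwa [(extChartAt (𝓡 n) q).left_inv hq] at this
  filter_upwards [hc.eventually f.eventuallyEq_one] with z hz
  simp only [X, hz, Pi.one_apply, one_smul]
  rw [coordForm, LinearMap.comp_apply]
  exact (component_apply_of_mem η t (map_mem_deg _ (extBasis_mem S))).trans (if_pos hS)

theorem component_eq_zero_of_lt (η : AssocForm n M) {t : ℕ} (ht : n < t) : η.component t = 0 := by
  funext p
  have hp := mem_extChartAt_source (I := 𝓡 n) p
  refine LinearMap.ext fun x => ?_
  rw [AssocForm.component, LinearMap.comp_apply]
  have hx : GradedAlgebra.proj (fun i : ℕ => ⋀[ℝ]^i (TangentSpace (𝓡 n) p)) t x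
      ∈ ⋀[ℝ]^t (TangentSpace (𝓡 n) p) := Subtype.prop _
  have : GradedAlgebra.proj (fun i : ℕ => ⋀[ℝ]^i (TangentSpace (𝓡 n) p)) t x = 0 := by
    apply chartExt_injective hp
    rw [map_zero]
    exact eq_zero_of_mem_of_lt ht (map_mem_deg _ hx)
  rw [this, map_zero]
  rfl

end

section

/-! ## The global higher connection -/

variable {n : ℕ} {M : Type*} [TopologicalSpace M] [ChartedSpace (Model n) M]
  [IsManifold (𝓡 n) ∞ M]

omit [IsManifold (𝓡 n) ∞ M] in
theorem MVF.HasDegree.coordMVF_mem {k : ℕ} {X : MVF n M} (hX : X.HasDegree k) (a : M)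
    (z : Model n) : coordMVF X.1 a z ∈ ⋀[ℝ]^k (Model n) := map_mem_deg _ (hX _)

omit [IsManifold (𝓡 n) ∞ M] in
theorem MVF.differentiableAt (X : MVF n M) {a q : M} (ha : q ∈ (extChartAt (𝓡 n) a).source) :
    DifferentiableAt ℝ (coordMVF X.1 a) (extChartAt (𝓡 n) a q) :=
  (IsSmoothMVF.contDiffAt X.2 ha).differentiableAt (by simp)

theorem ofFun_mul_apply (f : C^∞⟮𝓡 n, M; ℝ⟯) (X : MVF n M) (p : M) :
    (ofFun f * X).1 p = f p • X.1 p := (Algebra.smul_def (f p) (X.1 p)).symm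

theorem coordMVF_ofFun_mul (f : C^∞⟮𝓡 n, M; ℝ⟯) (X : MVF n M) (a : M) :
    coordMVF (ofFun f * X).1 a =
      fun z => f ((extChartAt (𝓡 n) a).symm z) • coordMVF X.1 a z := by
  funext z
  rw [coordMVF, ofFun_mul_apply, map_smul, coordMVF]

theorem coordMVF_ofFun (f : C^∞⟮𝓡 n, M; ℝ⟯) (a : M) :
    coordMVF (ofFun f).1 a =
      fun z => algebraMap ℝ (Ext n) (f ((extChartAt (𝓡 n) a).symm z)) := by
  funext z
  exact AlgHom.commutes _ _

theorem differentiableAt_chart (f : C^∞⟮𝓡 n, M; ℝ⟯) {a q : M}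
    (ha : q ∈ (extChartAt (𝓡 n) a).source) :
    DifferentiableAt ℝ (fun z => f ((extChartAt (𝓡 n) a).symm z)) (extChartAt (𝓡 n) a q) :=
  (contDiffAt_chart_of_contMDiff f.contMDiff ha).differentiableAt (by simp)

/-- The connection in the chart around `a`, evaluated at `p`. -/
def chartCov (η : AssocForm n M) (T : Finset ℕ) (X Y : RoughMVF n M) (p a : M) : Ext n :=
  locCov T (fun t => coordForm (η.component t) a) (coordMVF X a) (coordMVF Y a)
    (extChartAt (𝓡 n) a p)

/-- The degrees of the components of `η` that have to be made parallel. -/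
def activeDegrees (η : AssocForm n M) : Finset ℕ :=
  open Classical in (Finset.range (n + 1)).filter fun t => 1 < t ∧ η.component t ≠ 0

theorem component_eq_zero_of_notMem {η : AssocForm n M} (h1 : η.component 1 = 0) {t : ℕ}
    (ht : 0 < t) (hT : t ∉ activeDegrees η) : η.component t = 0 := by
  by_contra h
  refine hT ?_
  simp only [activeDegrees, Finset.mem_filter, Finset.mem_range]
  refine ⟨?_, ?_, h⟩
  · by_contra hn
    exact h (component_eq_zero_of_lt η (by omega))
  · rcases Nat.lt_or_ge 1 t with h' | h'
    · exact h'
    · obtain rfl : t = 1 := by omega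
      exact absurd h1 h

omit [IsManifold (𝓡 n) ∞ M] in
theorem one_notMem_activeDegrees (η : AssocForm n M) : 1 ∉ activeDegrees η := by
  simp [activeDegrees]

omit [IsManifold (𝓡 n) ∞ M] in
theorem AssocForm.IsNonvanishing.component_ne_zero {η : AssocForm n M} (hη : η.IsNonvanishing)
    {t : ℕ} (ht : t ∈ activeDegrees η) (p : M) : η.component t p ≠ 0 := by
  simp only [activeDegrees, Finset.mem_filter] at ht
  exact hη.2 t ht.2.1 ht.2.2 p

theorem coordForm_ne_zero {α : RoughForm n M} {a p : M} (ha : p ∈ (extChartAt (𝓡 n) a).source)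
    (h : α p ≠ 0) : coordForm α a (extChartAt (𝓡 n) a p) ≠ 0 := by
  intro h0
  refine h (LinearMap.ext fun x => ?_)
  rw [← coordForm_apply ha, h0]
  rfl

/-- The correction vanishes here because `posPart` discards degree `0`. With the Leibniz rule at `Y
= 1` this gives `∇_X f = [X, f]`. -/
theorem locCov_one {T : Finset ℕ} {w : ℕ → Model n → Module.Dual ℝ (Ext n)}
    {P : Model n → Ext n} {y : Model n} : locCov T w P (fun _ => 1) y = 0 := by
  have h : (1 : Ext n) ∈ ⋀[ℝ]^0 (Model n) := SetLike.one_mem_graded _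
  simp [locCov, flatCov, corrCoeff, partialMV_eq (differentiableAt_const _), posPart_of_mem h]

/-! ### Gluing the chart connections, and transfer of torsion and parallelism. -/

section

variable {ρ : SmoothPartitionOfUnity M (𝓡 n) M Set.univ} [T2Space M]

theorem isSmoothMVF_cov (hρ : ρ.IsSubordinate fun a => (chartAt (Model n) a).source)
    {η : AssocForm n M} (hη : η.IsNonvanishing) (X Y : MVF n M) :
    IsSmoothMVF (n := n) fun p => glueAt ρ p (chartCov η (activeDegrees η) X.1 Y.1 p) :=
  isSmoothMVF_glueAt hρ fun a q hq => contDiffAt_locCov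
    (fun t _ => isSmoothForm_component η t a q hq)
    (fun _ ht => coordForm_ne_zero hq (hη.component_ne_zero ht q))
    (IsSmoothMVF.contDiffAt X.2 hq) (IsSmoothMVF.contDiffAt Y.2 hq)

/-- The glued covariant derivative. -/
def gluedCov (hρ : ρ.IsSubordinate fun a => (chartAt (Model n) a).source)
    {η : AssocForm n M} (hη : η.IsNonvanishing) (X Y : MVF n M) : MVF n M :=
  ⟨fun p => glueAt ρ p (chartCov η (activeDegrees η) X.1 Y.1 p), isSmoothMVF_cov hρ hη X Y⟩

theorem differentiableAt_component (η : AssocForm n M) (t : ℕ) {a q : M}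
    (ha : q ∈ (extChartAt (𝓡 n) a).source) :
    DifferentiableAt ℝ (coordForm (η.component t) a) (extChartAt (𝓡 n) a q) :=
  (isSmoothForm_component η t a q ha).differentiableAt (by simp)

theorem gluedCov_leibniz (hρ : ρ.IsSubordinate fun a => (chartAt (Model n) a).source)
    {η : AssocForm n M} (hη : η.IsNonvanishing) (f : C^∞⟮𝓡 n, M; ℝ⟯) (X Y : MVF n M) :
    (gluedCov hρ hη X (ofFun f * Y)).1 =
      schouten X.1 (ofFun f).1 * Y.1 + (ofFun f * gluedCov hρ hη X Y).1 := by
  funext p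
  rw [Pi.add_apply, Pi.mul_apply, ofFun_mul_apply]
  have h : ∀ a, p ∈ (extChartAt (𝓡 n) a).source →
      chartCov η (activeDegrees η) X.1 (ofFun f * Y).1 p a =
        ((fun a => chartExt a p (schouten X.1 (ofFun f).1 p * Y.1 p)) +
          f p • chartCov η (activeDegrees η) X.1 Y.1 p) a := by
    intro a ha
    rw [chartCov, coordMVF_ofFun_mul, locCov_leibniz (differentiableAt_chart f ha)
      (Y.differentiableAt ha), ← coordMVF_ofFun, ← chartExt_schouten X.2 (ofFun f).2 ha,
      coordMVF_apply ha, ← map_mul, (extChartAt (𝓡 n) a).left_inv ha]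
    rfl
  change glueAt ρ p _ = _ + f p • glueAt ρ p _
  rw [glueAt_congr hρ h, map_add, map_smul, glueAt_eq hρ fun a _ => rfl]

theorem gluedCov_one (hρ : ρ.IsSubordinate fun a => (chartAt (Model n) a).source)
    {η : AssocForm n M} (hη : η.IsNonvanishing) (X : MVF n M) : gluedCov hρ hη X 1 = 0 := by
  refine Subtype.ext (funext fun p => glueAt_eq hρ (v := 0) fun a _ => ?_)
  have h : coordMVF (1 : MVF n M).1 a = fun _ => 1 := funext fun z => map_one _
  rw [chartCov, h, locCov_one, map_zero]

/-- The higher connection glued from the chart connections. -/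
def gluedConnection (hρ : ρ.IsSubordinate fun a => (chartAt (Model n) a).source)
    {η : AssocForm n M} (hη : η.IsNonvanishing) : HigherConnection n M where
  cov := gluedCov hρ hη
  hasDegree_cov {k l j X Y} hj hX hY p := by
    refine glueAt_mem fun a ha => ?_
    have ha' := mem_source_of_mem_finsupport hρ ha
    exact locCov_mem (fun t _ => differentiableAt_component η t ha')
      (fun t _ => Filter.Eventually.of_forall fun z => isDegForm_component η t a z)
      (Y.differentiableAt ha') (hX.coordMVF_mem a _)
      (Filter.Eventually.of_forall fun z => hY.coordMVF_mem a z) hj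
  cov_linear_left f X X' Y := by
    refine Subtype.ext (funext fun p => ?_)
    change _ = (ofFun f * gluedCov hρ hη X Y).1 p + (gluedCov hρ hη X' Y).1 p
    rw [ofFun_mul_apply]
    change glueAt ρ p _ = f p • glueAt ρ p _ + glueAt ρ p _
    rw [← map_smul, ← map_add]
    refine glueAt_congr hρ fun a ha => locCov_linear_left (f p) ?_
    rw [coordMVF_apply ha, coordMVF_apply ha, coordMVF_apply ha, ← map_smul, ← map_add,
      ← ofFun_mul_apply]
    rfl
  cov_add_right X Y Y' := by
    refine Subtype.ext (funext fun p => ?_)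
    change glueAt ρ p _ = glueAt ρ p _ + glueAt ρ p _
    rw [← map_add]
    refine glueAt_congr hρ fun a ha => ?_
    have h : coordMVF (Y + Y').1 a = fun z => coordMVF Y.1 a z + coordMVF Y'.1 a z :=
      funext fun z => map_add _ _ _
    rw [chartCov, h]
    exact locCov_add_right (Y.differentiableAt ha) (Y'.differentiableAt ha)
  cov_ofFun_right {_ X} f _ := by
    have h := gluedCov_leibniz hρ hη f X 1
    rw [gluedCov_one, mul_zero, mul_one] at h
    rw [h]
    change _ * (1 : RoughMVF n M) + (0 : RoughMVF n M) = _
    rw [mul_one, add_zero]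
  cov_leibniz f Y _ := gluedCov_leibniz hρ hη f _ Y
  cov_ofFun_left f X := by
    refine Subtype.ext (funext fun p => glueAt_eq hρ (v := 0) fun a _ => ?_)
    rw [map_zero]
    refine locCov_of_mem_zero ?_
    rw [coordMVF_ofFun]
    exact algebraMap_mem_deg _

/-- Gluing is linear in the chart values and the bracket is the same in every chart, so the torsion
may be checked chart by chart. -/
theorem gluedConnection_torsion (hρ : ρ.IsSubordinate fun a => (chartAt (Model n) a).source)
    {η : AssocForm n M} (hη : η.IsNonvanishing) {k l : ℕ} {X Y : MVF n M}
    (h : ∀ p a : M, p ∈ (extChartAt (𝓡 n) a).source →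
      chartCov η (activeDegrees η) X.1 Y.1 p a
        - (-1 : ℝ) ^ (((k : ℤ) - 1) * ((l : ℤ) - 1)) • chartCov η (activeDegrees η) Y.1 X.1 p a
      = schoutenLocal (coordMVF X.1 a) (coordMVF Y.1 a) (extChartAt (𝓡 n) a p)) :
    (gluedConnection hρ hη).torsion k l X Y = 0 := by
  funext p
  change glueAt ρ p _ - (_ : ℝ) • glueAt ρ p _ - schouten X.1 Y.1 p = 0
  rw [sub_eq_zero, ← map_smul, ← map_sub]
  refine glueAt_eq hρ fun a ha => ?_
  rw [chartExt_schouten X.2 Y.2 ha, ← h p a ha]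
  rfl

theorem gluedConnection_almostTorsionFree
    (hρ : ρ.IsSubordinate fun a => (chartAt (Model n) a).source)
    {η : AssocForm n M} (hη : η.IsNonvanishing) :
    (gluedConnection hρ hη).AlmostTorsionFree := by
  refine ⟨fun X Y hX hY => gluedConnection_torsion hρ hη fun p a ha => ?_,
    fun k l X Y hX hY hXY => gluedConnection_torsion hρ hη fun p a ha => ?_⟩
  · exact locCov_torsion_one (one_notMem_activeDegrees η)
      (fun t _ => differentiableAt_component η t ha)
      (fun t _ => Filter.Eventually.of_forall fun z => isDegForm_component η t a z)
      (X.differentiableAt ha) (Filter.Eventually.of_forall fun z => hX.coordMVF_mem a z)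
      (hY.coordMVF_mem a _)
  · refine locCov_torsion (X.differentiableAt ha)
      (Filter.Eventually.of_forall fun z => hX.coordMVF_mem a z) (hY.coordMVF_mem a _) ?_
    rw [coordMVF_apply ha, coordMVF_apply ha, ← map_mul]
    have : X.1 p * Y.1 p = (X * Y).1 p := rfl
    rw [this, hXY]
    exact map_zero _

omit [T2Space M] in
/-- `(L_X i_W α)(1) = -(-1)^k (d i_W α)(X)` in an arbitrary chart. -/
theorem lieDerivForm_interior_one {α : RoughForm n M} (hα : IsSmoothForm α) (k : ℕ)
    (X W : MVF n M) {a p : M} (ha : p ∈ (extChartAt (𝓡 n) a).source) :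
    lieDerivForm k X.1 (interior W.1 α) p 1 =
      -((-1 : ℝ) ^ k * dLocal (contrForm (coordForm α a) (coordMVF W.1 a))
        (extChartAt (𝓡 n) a p) (coordMVF X.1 a (extChartAt (𝓡 n) a p))) := by
  have hW := IsSmoothForm.interior hα W.2
  rw [lieDerivForm, LinearMap.sub_apply, LinearMap.smul_apply, smul_eq_mul,
    extDerivForm_apply (hW.interior X.2) ha]
  change _ - _ * extDerivForm (interior W.1 α) p (X.1 p * 1) = _
  rw [mul_one, extDerivForm_apply hW ha, coordMVF_apply ha]
  -- The term `d i_X` contributes nothing on `1`: evaluating an exterior derivative contracts its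
  -- argument, and contraction kills scalars.
  have h1 : dLocal (coordForm (interior X.1 (interior W.1 α)) a) (extChartAt (𝓡 n) a p)
      (chartExt a p 1) = 0 := by
    simp [dLocal, contr_eq]
  rw [h1, zero_sub, dLocal, dLocal, (coordForm_interior ha W.1 α).fderiv_eq]

omit [IsManifold (𝓡 n) ∞ M] [T2Space M] in
theorem isSmoothForm_zero : IsSmoothForm (0 : RoughForm n M) := fun _ _ _ =>
  contDiffAt_const (c := (0 : Module.Dual ℝ (Ext n)))

theorem gluedConnection_isParallel
    (hρ : ρ.IsSubordinate fun a => (chartAt (Model n) a).source)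
    {η : AssocForm n M} (hη : η.IsNonvanishing) :
    η.IsParallel (gluedConnection hρ hη) := by
  intro k l m t X Y Z hX hY hZ hk hlm ht p
  have hW : (Y * Z).HasDegree (l + m) := fun q => SetLike.mul_mem_graded (hY q) (hZ q)
  rw [HigherConnection.covForm, sub_eq_zero]
  by_cases hT : t ∈ activeDegrees η
  · symm
    refine apply_glueAt hρ fun a ha => ?_
    rw [lieDerivForm_interior_one (isSmoothForm_component η t) k X (Y * Z) ha]
    exact apply_locCov (w := fun t => coordForm (η.component t) a) hT
      (fun t _ => differentiableAt_component η t ha)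
      (fun t _ => Filter.Eventually.of_forall fun z => isDegForm_component η t a z)
      (coordForm_ne_zero ha (hη.component_ne_zero hT p)) ((Y * Z).differentiableAt ha)
      (hX.coordMVF_mem a _) (Filter.Eventually.of_forall fun z => hW.coordMVF_mem a z) hlm
      (by omega)
  -- From `k > 0` and `l + m > 0` it follows that `t > 0`, so an inactive degree has zero component.
  -- Degree `0`, whose component is unrestricted, does not occur.
  · rw [component_eq_zero_of_notMem hη.1 (by omega) hT,
      lieDerivForm_interior_one isSmoothForm_zero k X (Y * Z) (mem_extChartAt_source p)]
    have h0 : contrForm (coordForm (0 : RoughForm n M) p) (coordMVF (Y * Z).1 p) =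
        fun _ => 0 := rfl
    rw [h0]
    simp [dLocal]

end

/-- If the form vanished at `p`, every tangent vector at `p` would lie in its kernel and hence be
zero. Then `n = 0 < t`, and the component would vanish identically. -/
theorem AssocForm.IsPlectic.isNonvanishing {η : AssocForm n M} (hη : η.IsPlectic) :
    η.IsNonvanishing := by
  refine ⟨hη.1, fun t ht h0 p hp => h0 ?_⟩
  have hv : ∀ v : TangentSpace (𝓡 n) p, v = 0 := by
    intro v
    rw [← (hη.2 t ht h0).2 p v, hp]
    rfl
  refine component_eq_zero_of_lt η ?_
  by_contra hn
  have : Nontrivial (Model n) := by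
    have : Nonempty (Fin n) := ⟨⟨0, by omega⟩⟩
    infer_instance
  obtain ⟨v, hv'⟩ := exists_ne (0 : Model n)
  exact hv' (hv v)

theorem exists_parallel_connection [T2Space M] [SecondCountableTopology M] {η : AssocForm n M}
    (hη : η.IsNonvanishing) :
    ∃ D : HigherConnection n M, D.AlmostTorsionFree ∧ η.IsParallel D := by
  have : LocallyCompactSpace M := ChartedSpace.locallyCompactSpace (Model n) M
  obtain ⟨ρ, hρ⟩ := SmoothPartitionOfUnity.exists_isSubordinate_chartAt_source (𝓡 n) M
  exact ⟨gluedConnection hρ hη, gluedConnection_almostTorsionFree hρ hη,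
    gluedConnection_isParallel hρ hη⟩

end

end HigherConn

end

open HigherConn in
theorem mainTheorem12 (n : ℕ) (M : Type*) [TopologicalSpace M] [T2Space M]
    [SecondCountableTopology M] [ChartedSpace (EuclideanSpace ℝ (Fin n)) M]
    [IsManifold (𝓡 n) ∞ M] :
    (∀ η : AssocForm n M, η.IsNonvanishing →
      ∃ D : HigherConnection n M, D.AlmostTorsionFree ∧ η.IsParallel D) ∧
    (∀ η : AssocForm n M, η.IsPlectic →
      ∃ D : HigherConnection n M, D.AlmostTorsionFree ∧ η.IsParallel D) :=
  ⟨fun _ hη => exists_parallel_connection hη, fun _ hη =>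
    exists_parallel_connection hη.isNonvanishing⟩
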